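/- **Theorem 5.** Let $K, N_T, N_R \ge 1$ be integers and $R>0$. For $k=1,\dots,K$ let ${\bf H}_k={\bf u}_k{\bf v}_k^{\rm H}$ be the keyhole channel matrix of the $k$-th HARQ round, where ${\bf u}_k\sim\mathcal{CN}({\bf 0},{\bf I}_{N_R})$ and ${\bf v}_k\sim\mathcal{CN}({\bf 0},{\bf I}_{N_T})$ are independent, and let ${\bf H}_1,\dots,{\bf H}_K$ be independent. For average transmit SNRs $\gamma_1,\dots,\gamma_K>0$ let $$P_{out}^{IR}=\Pr\Big(\sum_{k=1}^K\log_2\det\Big({\bf I}_{N_R}+\frac{\gamma_k}{N_T}{\bf H}_k{\bf H}_k^{\rm H}\Big)<R\Big)$$ be the outage probability of the MIMO-HARQ-IR scheme at transmission rate $R$. Put $m=\min(N_T,N_R)$, $M=\max(N_T,N_R)$, $\tau=|N_T-N_R|$, and let $$G=G^{0,K+1}_{K+1,K+1}\left(\left.\begin{array}{c}1,m+1,\dots,m+1\\1,\dots,1,0\end{array}\right|2^R\right)=\frac1{2\pi{\rm i}}\int_{c-{\rm i}\infty}^{c+{\rm i}\infty}\frac{\Gamma(s)\,\Gamma(s-m)^K}{\Gamma(s)^K\,\Gamma(s+1)}\,2^{Rs}\,ds\qquad(c>m)$$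 be the value of the Meijer G-function ($m+1$ and $1$ occurring $K$ times each in the upper and lower rows beside the single entries $1$ and $0$); the integral converges absolutely and does not depend on $c>m$. Then, as $\gamma_k\to\infty$ for all $k$ (independently of each other), $$P_{out}^{IR}\simeq\begin{cases}\displaystyle\prod_{k=1}^K\frac{\Gamma(\tau)\left(\frac{N_T}{\gamma_k}\right)^{m}}{\Gamma(M)}\;G, & N_T\ne N_R,\\[3ex]\displaystyle\prod_{k=1}^K\frac{\left(\frac{N_T}{\gamma_k}\right)^{m}\ln\gamma_k}{\Gamma(M)}\;G, & N_T=N_R,\end{cases}$$ where $\simeq$ means that the ratio of the two sides tends to $1$ and the factor $G$ stands outside the product over $k$. -/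

import Mathlib

open MeasureTheory ProbabilityTheory Filter Asymptotics

noncomputable section

/-- The Mellin–Barnes integrand of the Meijer G-function `G^{m,n}_{p,q}(a; b | z)`:
`∏_{j ≤ m} Γ(b_j - s) ∏_{j ≤ n} Γ(1 - a_j + s) /
  (∏_{j > m} Γ(1 - b_j + s) ∏_{j > n} Γ(a_j - s)) * z ^ s`.
(A pole of a Gamma factor in the denominator gives the value `0`, as it should.) -/
def meijerGIntegrand (m n : ℕ) {p q : ℕ} (a : Fin p → ℂ) (b : Fin q → ℂ) (z s : ℂ) : ℂ :=
  ((∏ j : Fin q, if (j : ℕ) < m then Complex.Gamma (b j - s) else 1) *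
      ∏ j : Fin p, if (j : ℕ) < n then Complex.Gamma (1 - a j + s) else 1) /
    ((∏ j : Fin q, if (j : ℕ) < m then 1 else Complex.Gamma (1 - b j + s)) *
      ∏ j : Fin p, if (j : ℕ) < n then 1 else Complex.Gamma (a j - s)) * z ^ s

/-- The vertical line `Re s = c` has all poles of `Γ(b_j - s)`, `j ≤ m`, on its right and all
poles of `Γ(1 - a_j + s)`, `j ≤ n`, on its left. -/
def MeijerGSeparates (m n : ℕ) {p q : ℕ} (a : Fin p → ℂ) (b : Fin q → ℂ) (c : ℝ) : Prop :=
  (∀ j : Fin q, (j : ℕ) < m → c < (b j).re) ∧ (∀ j : Fin p, (j : ℕ) < n → (a j).re - 1 < c)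

/-- The contour integral `(2πi)⁻¹ ∫_{c - i∞}^{c + i∞}` of the Mellin–Barnes integrand,
parametrized by `s = c + i t`, `ds = i dt`. -/
def meijerGLine (m n : ℕ) {p q : ℕ} (a : Fin p → ℂ) (b : Fin q → ℂ) (z : ℂ) (c : ℝ) : ℂ :=
  (2 * Real.pi * Complex.I)⁻¹ *
    ∫ t : ℝ, meijerGIntegrand m n a b z (c + t * Complex.I) * Complex.I

open Classical in
/-- The Meijer G-function `G^{m,n}_{p,q}(a; b | z)` as the Mellin–Barnes integral along a vertical
line that separates the two families of poles. -/
def meijerG (m n : ℕ) {p q : ℕ} (a : Fin p → ℂ) (b : Fin q → ℂ) (z : ℂ) : ℂ :=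
  if h : ∃ c : ℝ, MeijerGSeparates m n a b c then meijerGLine m n a b z h.choose else 0

/-- The standard complex normal law `CN(0, 1)`: independent real and imaginary parts with law
`N(0, 1/2)`. -/
def stdComplexNormal : Measure ℂ :=
  ((gaussianReal 0 (1 / 2)).prod (gaussianReal 0 (1 / 2))).map
    Complex.measurableEquivRealProd.symm

/-- The keyhole channel matrix `H = u vᴴ`. -/
def keyholeChannel {NT NR : ℕ} (u : Fin NR → ℂ) (v : Fin NT → ℂ) : Matrix (Fin NR) (Fin NT) ℂ :=
  Matrix.vecMulVec u (star v)

/-- The accumulated mutual information `∑_k log₂ det (I + (γ_k / N_T) H_k H_kᴴ)` of HARQ-IR (the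
determinant of a Hermitian matrix is real, so that `.re` only changes its type). -/
def mutualInfoIR {K NT NR : ℕ} (γ : Fin K → ℝ) (H : Fin K → Matrix (Fin NR) (Fin NT) ℂ) : ℝ :=
  ∑ k, Real.logb 2
    ((1 + ((γ k / NT : ℝ) : ℂ) • (H k * (H k).conjTranspose)).det).re

/-- The outage probability `Pr (I < R)` of HARQ-IR. -/
def outageIR {Ω : Type*} [MeasurableSpace Ω] (μ : Measure Ω) {K NT NR : ℕ}
    (H : Fin K → Ω → Matrix (Fin NR) (Fin NT) ℂ) (R : ℝ) (γ : Fin K → ℝ) : ℝ :=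
  μ.real {ω | mutualInfoIR γ (fun k => H k ω) < R}

/-- The upper parameters `1, m + 1, …, m + 1` (`m + 1` repeated `K` times). -/
def upperParams (K m : ℕ) : Fin (K + 1) → ℂ := Fin.cons 1 (fun _ : Fin K => (m : ℂ) + 1)

/-- The lower parameters `1, …, 1, 0` (`1` repeated `K` times). -/
def lowerParams (K : ℕ) : Fin (K + 1) → ℂ :=
  Fin.snoc (α := fun _ => ℂ) (fun _ : Fin K => (1 : ℂ)) 0

end

open Set Topology

/-! A keyhole channel has rank one, so the determinant of round k is 1 + (γ_k/N_T)‖u_k‖²‖v_k‖²,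
where the two squared norms are independent Gamma variables of shapes N_R and N_T. Outage is thus
the event ∏ (1 + y_k) < 2^R for independent y_k = (γ_k/N_T)‖u_k‖²‖v_k‖² (`outageIR_eq_setIntegral`).

The product of Gamma variables of shapes m and M = m + τ has density x^(m-1) J(x) / (Γ(m)Γ(M)) with
J = `besselTypeIntegral τ`. As x → 0, J(x) tends to Γ(τ) if τ ≥ 1 and grows like -log x if τ = 0.
For y_k the argument is x = N_T y/γ_k, so its density is `outageScale` times y^(m-1)/Γ(m) times a
factor tending to 1. On the positive orthant the region is bounded, since 1 + y_k ≤ ∏ (1 + y_i), and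
the last factor is at most C(1 + |log y|). Dominated convergence shows that the outage probability
divided by the scales tends to V(2^R), V = `hyperbolicMass`
(`tendsto_setIntegral_prod_powerDensity_mul`).

It remains to see that V(x) is the Meijer G-value. By Fubini and the beta integral, t ↦ V(1/t) has
Mellin transform s⁻¹(Γ(s-m)/Γ(s))^K for Re s > m (`hasMellin_hyperbolicMass_inv`), which is the
Mellin–Barnes integrand without x^s. As V is continuous and the transform is integrable on vertical
lines, Mellin inversion applies (`meijerGLine_outage_eq`). Since V(x) > 0 for x > 1, the limit is an
asymptotic equivalence. -/

/-! ### Squared norms of complex Gaussian vectors are Gamma distributed -/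

theorem integrableOn_pow_mul_exp_neg (n : ℕ) :
    IntegrableOn (fun x : ℝ => x ^ n * Real.exp (-x)) (Ioi 0) := by
  have h := Real.GammaIntegral_convergent (s := n + 1) (by positivity)
  refine h.congr_fun (fun x _ => ?_) measurableSet_Ioi
  simp [mul_comm]

theorem tendsto_pow_mul_exp_neg_complex (n : ℕ) (t : ℝ) :
    Tendsto (fun x : ℝ => (x : ℂ) ^ n * Complex.exp (-(1 - t * Complex.I) * x)) atTop (𝓝 0) := by
  rw [tendsto_zero_iff_norm_tendsto_zero]
  refine (Real.tendsto_pow_mul_exp_neg_atTop_nhds_zero n).congr' ?_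
  filter_upwards [eventually_ge_atTop 0] with x hx
  simp [Complex.norm_exp, abs_of_nonneg hx]

theorem integrableOn_pow_mul_exp_neg_complex (n : ℕ) (t : ℝ) :
    IntegrableOn (fun x : ℝ => (x : ℂ) ^ n * Complex.exp (-(1 - t * Complex.I) * x)) (Ioi 0) := by
  refine (integrableOn_pow_mul_exp_neg n).mono' (by fun_prop) ?_
  filter_upwards [ae_restrict_mem measurableSet_Ioi] with x hx
  simp [Complex.norm_exp, abs_of_pos (mem_Ioi.1 hx)]

/-- With z = 1 - it, integrating the derivative of x^(n+1) e^(-zx) over the half-line gives the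
recursion from n to n + 1. -/
theorem integral_pow_mul_exp_neg_complex (n : ℕ) (t : ℝ) :
    ∫ x in Ioi (0 : ℝ), (x : ℂ) ^ n * Complex.exp (-(1 - t * Complex.I) * x) =
      n.factorial * ((1 - t * Complex.I)⁻¹) ^ (n + 1) := by
  have hz : (1 - t * Complex.I : ℂ) ≠ 0 := fun h => by simpa using congrArg Complex.re h
  induction n with
  | zero =>
    have := integral_exp_mul_complex_Ioi (a := -(1 - t * Complex.I)) (by simp) 0
    simp only [pow_zero, one_mul, this, zero_add, pow_one, Nat.factorial_zero, Nat.cast_one,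
      Complex.ofReal_zero, mul_zero, Complex.exp_zero, neg_div_neg_eq, one_div]
  | succ n ih =>
    have hd : ∀ x ∈ Ici (0 : ℝ), HasDerivAt
        (fun x : ℝ => (x : ℂ) ^ (n + 1) * Complex.exp (-(1 - t * Complex.I) * x))
        ((n + 1) * ((x : ℂ) ^ n * Complex.exp (-(1 - t * Complex.I) * x)) -
          (1 - t * Complex.I) *
            ((x : ℂ) ^ (n + 1) * Complex.exp (-(1 - t * Complex.I) * x))) x := by
      intro x _
      have h1 : HasDerivAt (fun z : ℂ => z ^ (n + 1) * Complex.exp (-(1 - t * Complex.I) * z))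
          (((n + 1 : ℕ) : ℂ) * (x : ℂ) ^ n * Complex.exp (-(1 - t * Complex.I) * x) +
            (x : ℂ) ^ (n + 1) *
              (Complex.exp (-(1 - t * Complex.I) * x) * (-(1 - t * Complex.I) * 1))) x := by
        exact (hasDerivAt_pow (n + 1) (x : ℂ)).fun_mul
          (((hasDerivAt_id' (x : ℂ)).const_mul (-(1 - t * Complex.I))).cexp)
      convert h1.comp_ofReal using 1
      push_cast
      ring
    have hi := ((integrableOn_pow_mul_exp_neg_complex n t).const_mul ((n : ℂ) + 1))
    have hi' := ((integrableOn_pow_mul_exp_neg_complex (n + 1) t).const_mul (1 - t * Complex.I))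
    have h := integral_Ioi_of_hasDerivAt_of_tendsto' hd (hi.sub hi')
      (tendsto_pow_mul_exp_neg_complex (n + 1) t)
    rw [integral_sub hi hi', integral_const_mul, integral_const_mul, ih] at h
    simp only [Complex.ofReal_zero, ne_eq, Nat.succ_ne_zero, not_false_eq_true, zero_pow, zero_mul,
      sub_zero, sub_eq_zero] at h
    rw [← mul_right_inj' hz, ← h, Nat.factorial_succ]
    rw [pow_succ' _ (n + 1), mul_left_comm (((n + 1) * n.factorial : ℕ) : ℂ),
      mul_inv_cancel_left₀ hz]
    push_cast
    ring

theorem charFun_gammaMeasure_nat (n : ℕ) (t : ℝ) :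
    charFun (gammaMeasure (n + 1 : ℕ) 1) t = ((1 - t * Complex.I)⁻¹) ^ (n + 1) := by
  rw [charFun_apply_real, gammaMeasure]
  have hm : Measurable (gammaPDF (n + 1 : ℕ) 1) := (measurable_gammaPDFReal _ _).ennreal_ofReal
  rw [integral_withDensity_eq_integral_toReal_smul hm
    (ae_of_all _ fun _ => ENNReal.ofReal_lt_top)]
  have h0 : ∀ x : ℝ, x ∉ Ici (0 : ℝ) →
      (gammaPDF (n + 1 : ℕ) 1 x).toReal • Complex.exp (t * x * Complex.I) = 0 := by
    intro x hx
    rw [gammaPDF_of_neg (by simpa using hx)]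
    simp
  rw [← setIntegral_eq_integral_of_forall_compl_eq_zero h0, integral_Ici_eq_integral_Ioi]
  have h1 : ∀ x ∈ Ioi (0 : ℝ), (gammaPDF (n + 1 : ℕ) 1 x).toReal • Complex.exp (t * x * Complex.I) =
      (n.factorial : ℂ)⁻¹ * ((x : ℂ) ^ n * Complex.exp (-(1 - t * Complex.I) * x)) := by
    intro x hx
    have hx : 0 < x := hx
    rw [gammaPDF, ENNReal.toReal_ofReal (gammaPDFReal_nonneg (by positivity) one_pos x),
      gammaPDFReal, if_pos hx.le]
    have : Complex.exp (-(1 - t * Complex.I) * x) =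
        Complex.exp (-x) * Complex.exp (t * x * Complex.I) := by
      rw [← Complex.exp_add]; ring_nf
    rw [this]
    have : Real.Gamma ((n + 1 : ℕ) : ℝ) = n.factorial := by
      push_cast; exact Real.Gamma_nat_eq_factorial n
    rw [this]
    simp [mul_assoc]
  rw [setIntegral_congr_fun measurableSet_Ioi h1, integral_const_mul,
    integral_pow_mul_exp_neg_complex, ← mul_assoc, inv_mul_cancel₀, one_mul]
  exact_mod_cast n.factorial_ne_zero

/-- The square is what two independent real parts contribute; it also avoids choosing a branch of (1
- it)^(-1/2). -/
theorem integral_gaussianReal_exp_sq (t : ℝ) :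
    (∫ x, Complex.exp (t * (x : ℂ) ^ 2 * Complex.I) ∂(gaussianReal 0 (1 / 2))) ^ 2 =
      (1 - t * Complex.I)⁻¹ := by
  rw [integral_gaussianReal_eq_integral_smul (by simp)]
  have h1 : ∀ x : ℝ, gaussianPDFReal 0 (1 / 2) x • Complex.exp (t * (x : ℂ) ^ 2 * Complex.I) =
      ((√Real.pi)⁻¹ : ℝ) * Complex.exp (-(1 - t * Complex.I) * (x : ℂ) ^ 2) := by
    intro x
    rw [gaussianPDFReal]
    have : Complex.exp (-(1 - t * Complex.I) * (x : ℂ) ^ 2) =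
        Complex.exp (-x ^ 2) * Complex.exp (t * (x : ℂ) ^ 2 * Complex.I) := by
      rw [← Complex.exp_add]; ring_nf
    rw [this]
    have h2 : 2 * Real.pi * ((1 / 2 : NNReal) : ℝ) = Real.pi := by push_cast; ring
    have h3 : (2 : ℝ) * ((1 / 2 : NNReal) : ℝ) = 1 := by push_cast; ring
    rw [h2, h3]
    simp [mul_assoc]
  simp_rw [h1]
  rw [integral_const_mul, integral_gaussian_complex (by simp), mul_pow, ← Complex.cpow_nat_mul]
  norm_num
  rw [← Complex.ofReal_pow, Real.sq_sqrt Real.pi_pos.le]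
  have : (Real.pi : ℂ) ≠ 0 := by exact_mod_cast Real.pi_ne_zero
  field_simp

theorem charFun_map_norm_sq_stdComplexNormal (t : ℝ) :
    charFun (stdComplexNormal.map fun z => ‖z‖ ^ 2) t = (1 - t * Complex.I)⁻¹ := by
  rw [charFun_apply_real, stdComplexNormal, Measure.map_map (by fun_prop) (by fun_prop),
    integral_map (by fun_prop) (by fun_prop)]
  have h : ∀ p : ℝ × ℝ, Complex.exp (t * (((fun z : ℂ => ‖z‖ ^ 2) ∘
      Complex.measurableEquivRealProd.symm) p : ℝ) * Complex.I) =
      Complex.exp (t * (p.1 : ℂ) ^ 2 * Complex.I) *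
        Complex.exp (t * (p.2 : ℂ) ^ 2 * Complex.I) := by
    intro p
    rw [← Complex.exp_add]
    congr 1
    simp only [Function.comp_apply, ← Complex.normSq_eq_norm_sq, Complex.normSq_apply,
      Complex.measurableEquivRealProd_symm_apply]
    push_cast
    ring
  simp_rw [h]
  rw [integral_prod_mul (μ := gaussianReal 0 (1 / 2)) (ν := gaussianReal 0 (1 / 2))
    (fun x : ℝ => Complex.exp (t * (x : ℂ) ^ 2 * Complex.I))
    (fun x : ℝ => Complex.exp (t * (x : ℂ) ^ 2 * Complex.I)), ← sq, integral_gaussianReal_exp_sq]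

/-- Each |u_i|² has characteristic function (1 - it)⁻¹; by independence the sum has its n-th power,
which is that of the Gamma law, and characteristic functions determine laws. -/
theorem hasLaw_sum_norm_sq_of_stdComplexNormal {Ω : Type*} [MeasurableSpace Ω] {μ : Measure Ω}
    [IsProbabilityMeasure μ] {n : ℕ} (hn : 1 ≤ n) {u : Fin n → Ω → ℂ}
    (hu : ∀ i, HasLaw (u i) stdComplexNormal μ) (hind : iIndepFun u μ) :
    HasLaw (fun ω => ∑ i, ‖u i ω‖ ^ 2) (gammaMeasure n 1) μ := by
  obtain ⟨n, rfl⟩ := Nat.exists_eq_add_of_le' hn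
  have hm : ∀ i, AEMeasurable (fun ω => ‖u i ω‖ ^ 2) μ := fun i =>
    (hu i).aemeasurable.norm.pow_const 2
  have hm' : AEMeasurable (fun ω => ∑ i, ‖u i ω‖ ^ 2) μ := by fun_prop
  have := isProbabilityMeasure_gammaMeasure (a := (n + 1 : ℕ)) (r := 1) (by positivity) one_pos
  have := Measure.isProbabilityMeasure_map hm'
  refine ⟨hm', Measure.ext_of_charFun (funext fun t => ?_)⟩
  have hi : iIndepFun (fun i ω => ‖u i ω‖ ^ 2) μ :=
    hind.comp (fun _ z => ‖z‖ ^ 2) (fun _ => by fun_prop)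
  rw [hi.charFun_map_fun_sum_eq_prod hm, Finset.prod_apply, charFun_gammaMeasure_nat]
  have : ∀ i, charFun (μ.map fun ω => ‖u i ω‖ ^ 2) t = (1 - t * Complex.I)⁻¹ := by
    intro i
    rw [← charFun_map_norm_sq_stdComplexNormal, ← (hu i).map_eq,
      AEMeasurable.map_map_of_aemeasurable (by fun_prop) (hu i).aemeasurable]
    rfl
  simp [this]

/-- The two sums are functions of disjoint blocks of one independent family. -/
theorem iIndepFun_sumElim_indepFun_sum_norm_sq {Ω : Type*} [MeasurableSpace Ω] {μ : Measure Ω}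
    {ι κ : Type*} [Fintype ι] [Fintype κ] {u : ι → Ω → ℂ} {v : κ → Ω → ℂ}
    (hu : ∀ i, AEMeasurable (u i) μ) (hv : ∀ j, AEMeasurable (v j) μ)
    (h : iIndepFun (Sum.elim u v) μ) :
    IndepFun (fun ω => ∑ i, ‖u i ω‖ ^ 2) (fun ω => ∑ j, ‖v j ω‖ ^ 2) μ := by
  classical
  have hd : Disjoint (Finset.univ.map (Function.Embedding.inl : ι ↪ ι ⊕ κ))
      (Finset.univ.map (Function.Embedding.inr : κ ↪ ι ⊕ κ)) := by
    simp [Finset.disjoint_left]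
  have hφ : Measurable fun x : (Finset.univ.map (Function.Embedding.inl : ι ↪ ι ⊕ κ)) → ℂ =>
      ∑ i : ι, ‖x ⟨Sum.inl i, by simp⟩‖ ^ 2 :=
    Finset.measurable_sum _ fun i _ => ((measurable_pi_apply _).norm).pow_const 2
  have hψ : Measurable fun x : (Finset.univ.map (Function.Embedding.inr : κ ↪ ι ⊕ κ)) → ℂ =>
      ∑ j : κ, ‖x ⟨Sum.inr j, by simp⟩‖ ^ 2 :=
    Finset.measurable_sum _ fun i _ => ((measurable_pi_apply _).norm).pow_const 2
  have h1 := h.indepFun_finset₀ _ _ hd (by rintro (i | j) <;> simp [hu, hv])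
  exact h1.comp hφ hψ

/-! ### The determinant of a keyhole channel -/

/-- The sum of the squared absolute values of the entries of a complex matrix. -/
noncomputable def entrySqNorm {NT NR : ℕ} (A : Matrix (Fin NR) (Fin NT) ℂ) : ℝ :=
  ∑ i, ∑ j, ‖A i j‖ ^ 2

theorem measurable_entrySqNorm {NT NR : ℕ} :
    @Measurable (Matrix (Fin NR) (Fin NT) ℂ) ℝ MeasurableSpace.pi _ entrySqNorm := by
  change Measurable fun A : Fin NR → Fin NT → ℂ => ∑ i, ∑ j, ‖A i j‖ ^ 2
  fun_prop

theorem entrySqNorm_keyholeChannel {NT NR : ℕ} (u : Fin NR → ℂ) (v : Fin NT → ℂ) :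
    entrySqNorm (keyholeChannel u v) = (∑ i, ‖u i‖ ^ 2) * ∑ j, ‖v j‖ ^ 2 := by
  simp [entrySqNorm, keyholeChannel, Matrix.vecMulVec_apply, mul_pow, Finset.sum_mul_sum]

/-- H Hᴴ = ‖v‖² u uᴴ has rank one, so the matrix determinant lemma applies. -/
theorem det_one_add_smul_keyholeChannel {NT NR : ℕ} (c : ℝ) (u : Fin NR → ℂ) (v : Fin NT → ℂ) :
    ((1 + (c : ℂ) • (keyholeChannel u v * (keyholeChannel u v).conjTranspose)).det).re =
      1 + c * entrySqNorm (keyholeChannel u v) := by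
  have h : (c : ℂ) • (keyholeChannel u v * (keyholeChannel u v).conjTranspose) =
      Matrix.replicateCol Unit (((c * ∑ j, ‖v j‖ ^ 2 : ℝ) : ℂ) • u) *
        Matrix.replicateRow Unit (star u) := by
    ext i j
    have : ∀ k, star (v k) * v k = ((‖v k‖ ^ 2 : ℝ) : ℂ) := fun k => by
      rw [← Complex.normSq_eq_norm_sq, Complex.normSq_eq_conj_mul_self]; rfl
    simp only [Matrix.smul_apply, Matrix.mul_apply, keyholeChannel, Matrix.vecMulVec_apply,
      Matrix.conjTranspose_apply, Pi.star_apply, star_mul, star_star, smul_eq_mul,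
      Matrix.replicateCol_apply, Matrix.replicateRow_apply, Pi.smul_apply, Finset.univ_unique,
      Finset.sum_singleton, Complex.ofReal_mul, Complex.ofReal_sum, ← this]
    simp only [Finset.mul_sum, Finset.sum_mul]
    exact Finset.sum_congr rfl fun k _ => by ring
  rw [h, Matrix.det_one_add_replicateCol_mul_replicateRow, dotProduct_smul,
    entrySqNorm_keyholeChannel]
  have : star u ⬝ᵥ u = ((∑ i, ‖u i‖ ^ 2 : ℝ) : ℂ) := by
    simp only [dotProduct, Pi.star_apply, Complex.ofReal_sum]
    refine Finset.sum_congr rfl fun k _ => ?_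
    rw [← Complex.normSq_eq_norm_sq, Complex.normSq_eq_conj_mul_self]; rfl
  rw [this, smul_eq_mul, ← Complex.ofReal_mul, Complex.add_re, Complex.one_re, Complex.ofReal_re]
  ring

/-! ### Density of a product of two Gamma variables -/

/-- The integral `∫₀^∞ a ^ (τ - 1) exp (-a - x / a) da`, which is `2 x ^ (τ / 2) K_τ (2 √x)` with
the modified Bessel function `K_τ`. -/
noncomputable def besselTypeIntegral (τ : ℕ) (x : ℝ) : ℝ :=
  ∫ a in Ioi (0 : ℝ), a ^ τ * a⁻¹ * Real.exp (-a) * Real.exp (-(x / a))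

theorem inv_mul_exp_neg_div_le {a x : ℝ} (ha : 0 < a) (hx : 0 < x) :
    a⁻¹ * Real.exp (-(x / a)) ≤ x⁻¹ := by
  have h1 : x / a ≤ Real.exp (x / a) := by linarith [Real.add_one_le_exp (x / a)]
  rw [Real.exp_neg, ← mul_inv]
  refine inv_anti₀ hx ?_
  calc x = a * (x / a) := by field_simp
    _ ≤ _ := by gcongr

theorem integrableOn_besselTypeIntegrand (τ : ℕ) {x : ℝ} (hx : 0 < x) :
    IntegrableOn (fun a : ℝ => a ^ τ * a⁻¹ * Real.exp (-a) * Real.exp (-(x / a))) (Ioi 0) := by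
  refine ((integrableOn_pow_mul_exp_neg τ).mul_const x⁻¹).mono' (by fun_prop) ?_
  filter_upwards [ae_restrict_mem measurableSet_Ioi] with a ha
  have ha : 0 < a := ha
  rw [Real.norm_of_nonneg (by positivity)]
  calc a ^ τ * a⁻¹ * Real.exp (-a) * Real.exp (-(x / a)) =
      a ^ τ * Real.exp (-a) * (a⁻¹ * Real.exp (-(x / a))) := by ring
    _ ≤ _ := by gcongr; exact inv_mul_exp_neg_div_le ha hx

theorem besselTypeIntegral_nonneg (τ : ℕ) (x : ℝ) : 0 ≤ besselTypeIntegral τ x :=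
  setIntegral_nonneg measurableSet_Ioi fun a ha => by
    have : 0 < a := ha
    positivity

theorem measurable_besselTypeIntegral (τ : ℕ) : Measurable (besselTypeIntegral τ) := by
  have : StronglyMeasurable (Function.uncurry fun (x a : ℝ) =>
      a ^ τ * a⁻¹ * Real.exp (-a) * Real.exp (-(x / a))) := by
    apply Measurable.stronglyMeasurable
    unfold Function.uncurry
    fun_prop
  exact (this.integral_prod_right (ν := volume.restrict (Ioi 0))).measurable

/-- The density of the product of two independent Gamma variables of shapes `m` and `m + τ`. -/
noncomputable def gammaProductPDF (m τ : ℕ) (x : ℝ) : ℝ :=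
  if 0 < x then
    x ^ (m - 1) / (Real.Gamma m * Real.Gamma (m + τ : ℕ)) * besselTypeIntegral τ x else 0

theorem gammaProductPDF_nonneg (m τ : ℕ) (x : ℝ) : 0 ≤ gammaProductPDF m τ x := by
  unfold gammaProductPDF
  split_ifs with h
  · exact mul_nonneg (div_nonneg (pow_nonneg h.le _) (mul_nonneg (Real.Gamma_nonneg_of_nonneg
      (Nat.cast_nonneg _)) (Real.Gamma_nonneg_of_nonneg (Nat.cast_nonneg _))))
      (besselTypeIntegral_nonneg _ _)
  · rfl

theorem measurable_gammaProductPDF (m τ : ℕ) : Measurable (gammaProductPDF m τ) :=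
  Measurable.ite measurableSet_Ioi
    ((((measurable_id.pow_const _).div_const _)).mul (measurable_besselTypeIntegral τ))
    measurable_const

theorem lintegral_comp_mul_left_of_pos {f : ℝ → ENNReal} (hf : Measurable f) {a : ℝ} (ha : 0 < a) :
    ∫⁻ x, f (a * x) = ENNReal.ofReal a⁻¹ * ∫⁻ x, f x := by
  have h := lintegral_map (μ := volume) hf (measurable_const_mul a)
  rw [Real.map_volume_mul_left ha.ne', lintegral_smul_measure] at h
  rw [← h, abs_of_pos (inv_pos.2 ha), smul_eq_mul]

/-- The variable of the larger shape is integrated out: the factor a^(m-1) of its density cancels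
against (x/a)^(m-1) from the other one and leaves a^(τ-1). The point y = 0 is excluded because for m
= 1 the left side is positive there. -/
theorem lintegral_gammaPDF_mul_gammaPDF_div {m τ : ℕ} (hm : 1 ≤ m) {c : ℝ} (hc : 0 < c) {y : ℝ}
    (hy : y ≠ 0) :
    ∫⁻ a, gammaPDF (m + τ : ℕ) 1 a * (ENNReal.ofReal (c * a)⁻¹ * gammaPDF m 1 ((c * a)⁻¹ * y)) =
      ENNReal.ofReal (c⁻¹ * gammaProductPDF m τ (c⁻¹ * y)) := by
  have h0 : ∀ a : ℝ, a ∉ Ioi (0 : ℝ) → a ≠ 0 → gammaPDF (m + τ : ℕ) 1 a *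
      (ENNReal.ofReal (c * a)⁻¹ * gammaPDF m 1 ((c * a)⁻¹ * y)) = 0 := by
    intro a ha ha'
    rw [gammaPDF_of_neg (lt_of_le_of_ne (not_lt.1 ha) ha'), zero_mul]
  have hrestr : ∫⁻ a, gammaPDF (m + τ : ℕ) 1 a *
      (ENNReal.ofReal (c * a)⁻¹ * gammaPDF m 1 ((c * a)⁻¹ * y)) =
      ∫⁻ a in Ioi 0, gammaPDF (m + τ : ℕ) 1 a *
      (ENNReal.ofReal (c * a)⁻¹ * gammaPDF m 1 ((c * a)⁻¹ * y)) := by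
    rw [← lintegral_indicator measurableSet_Ioi]
    refine lintegral_congr_ae ?_
    filter_upwards [Measure.ae_ne volume (0 : ℝ)] with a ha
    by_cases h : a ∈ Ioi (0 : ℝ)
    · rw [indicator_of_mem h]
    · rw [indicator_of_notMem h, h0 a h ha]
  rw [hrestr]
  rcases hy.lt_or_gt with hy | hy
  · have : ¬ 0 < c⁻¹ * y := not_lt.2 (mul_nonpos_of_nonneg_of_nonpos (by positivity) hy.le)
    rw [gammaProductPDF, if_neg this, mul_zero, ENNReal.ofReal_zero]
    refine (setLIntegral_congr_fun measurableSet_Ioi fun a ha => ?_).trans lintegral_zero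
    have ha : 0 < a := ha
    rw [gammaPDF_of_neg (x := (c * a)⁻¹ * y) (mul_neg_of_pos_of_neg (by positivity) hy), mul_zero,
      mul_zero]
  · have hx : 0 < c⁻¹ * y := by positivity
    have hG : 0 < Real.Gamma m := Real.Gamma_pos_of_pos (by exact_mod_cast hm)
    have hG' : 0 < Real.Gamma (m + τ : ℕ) :=
      Real.Gamma_pos_of_pos (by exact_mod_cast (by omega : 0 < m + τ))
    rw [gammaProductPDF, if_pos hx, besselTypeIntegral, ← integral_const_mul, ← integral_const_mul,
      ofReal_integral_eq_lintegral_ofReal]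
    · refine setLIntegral_congr_fun measurableSet_Ioi fun a ha => ?_
      have ha : 0 < a := ha
      have hca : 0 < (c * a)⁻¹ * y := by positivity
      rw [gammaPDF_of_nonneg ha.le, gammaPDF_of_nonneg hca.le, ← ENNReal.ofReal_mul (by positivity),
        ← ENNReal.ofReal_mul (by positivity)]
      congr 1
      have e1 : ((m + τ : ℕ) : ℝ) - 1 = ((m - 1 + τ : ℕ) : ℝ) := by
        push_cast [Nat.cast_sub hm]; ring
      have e2 : (m : ℝ) - 1 = ((m - 1 : ℕ) : ℝ) := by push_cast [Nat.cast_sub hm]; ring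
      rw [e1, e2]
      simp only [Real.rpow_natCast, one_pow, one_mul]
      have e3 : (c * a)⁻¹ * y = (c⁻¹ * y) / a := by field_simp
      rw [e3, div_pow, pow_add]
      have : a ^ (m - 1) ≠ 0 := by positivity
      field_simp
    · exact (((integrableOn_besselTypeIntegrand τ hx).const_mul _).const_mul _)
    · filter_upwards [ae_restrict_mem measurableSet_Ioi] with a ha
      have : 0 < a := ha
      positivity

/-- For fixed first factor a > 0 the substitution y = c a b moves the density to y; Tonelli then
lets a be integrated first. -/
theorem map_const_mul_mul_prod_gammaMeasure {m τ : ℕ} (hm : 1 ≤ m) {c : ℝ} (hc : 0 < c) :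
    ((gammaMeasure (m + τ : ℕ) 1).prod (gammaMeasure m 1)).map (fun p => c * (p.1 * p.2)) =
      volume.withDensity fun y => ENNReal.ofReal (c⁻¹ * gammaProductPDF m τ (c⁻¹ * y)) := by
  have hP : ∀ n : ℕ, Measurable (gammaPDF n 1) := fun n =>
    (measurable_gammaPDFReal _ _).ennreal_ofReal
  have := isProbabilityMeasure_gammaMeasure (a := (m : ℕ)) (r := 1) (by positivity) one_pos
  ext s hs
  have hf : Measurable fun p : ℝ × ℝ => c * (p.1 * p.2) := by fun_prop
  have h1 : Measurable (s.indicator (1 : ℝ → ENNReal)) := measurable_one.indicator hs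
  have h1f : Measurable fun p : ℝ × ℝ => s.indicator (1 : ℝ → ENNReal) (c * (p.1 * p.2)) :=
    h1.comp hf
  rw [← lintegral_indicator_one hs, lintegral_map h1 hf,
    lintegral_prod _ h1f.aemeasurable, gammaMeasure,
    lintegral_withDensity_eq_lintegral_mul _ (hP _), withDensity_apply _ hs]
  swap
  · exact h1f.lintegral_prod_right'
  have step : ∀ a : ℝ, a ≠ 0 → (gammaPDF (m + τ : ℕ) 1 * fun a => ∫⁻ b, s.indicator 1 (c * (a * b))
      ∂(gammaMeasure m 1)) a = ∫⁻ y, s.indicator 1 y * (gammaPDF (m + τ : ℕ) 1 a *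
        (ENNReal.ofReal (c * a)⁻¹ * gammaPDF m 1 ((c * a)⁻¹ * y))) := by
    intro a ha
    rcases ha.lt_or_gt with ha | ha
    · simp [gammaPDF_of_neg ha]
    · have hca : 0 < c * a := by positivity
      have h2 : Measurable fun b => s.indicator (1 : ℝ → ENNReal) (c * (a * b)) :=
        h1.comp (by fun_prop)
      have h3 : Measurable fun y => s.indicator (1 : ℝ → ENNReal) y *
          gammaPDF m 1 ((c * a)⁻¹ * y) := h1.mul ((hP m).comp (by fun_prop))
      have h4 := lintegral_comp_mul_left_of_pos h3 hca
      rw [Pi.mul_apply, gammaMeasure, lintegral_withDensity_eq_lintegral_mul _ (hP _) h2]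
      have h5 : ∀ b, (gammaPDF m 1 * fun b => s.indicator (1 : ℝ → ENNReal) (c * (a * b))) b =
          s.indicator 1 (c * a * b) * gammaPDF m 1 ((c * a)⁻¹ * (c * a * b)) := by
        intro b
        rw [inv_mul_cancel_left₀ hca.ne', Pi.mul_apply, mul_comm, mul_assoc]
      rw [lintegral_congr h5, h4, ← mul_assoc, ← lintegral_const_mul _ h3]
      exact lintegral_congr fun y => by ring
  have hstep : ∀ᵐ a : ℝ, (gammaPDF (m + τ : ℕ) 1 * fun a => ∫⁻ b, s.indicator 1 (c * (a * b))
      ∂(gammaMeasure m 1)) a = ∫⁻ y, s.indicator 1 y * (gammaPDF (m + τ : ℕ) 1 a *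
        (ENNReal.ofReal (c * a)⁻¹ * gammaPDF m 1 ((c * a)⁻¹ * y))) := by
    filter_upwards [Measure.ae_ne volume (0 : ℝ)] with a ha using step a ha
  refine (lintegral_congr_ae hstep).trans ?_
  have hP' : Measurable fun p : ℝ × ℝ => gammaPDF (m + τ : ℕ) 1 p.1 *
      (ENNReal.ofReal (c * p.1)⁻¹ * gammaPDF m 1 ((c * p.1)⁻¹ * p.2)) :=
    ((hP _).comp measurable_fst).mul (Measurable.mul (by fun_prop) ((hP m).comp (by fun_prop)))
  rw [lintegral_lintegral_swap]
  swap
  · exact ((h1.comp measurable_snd).mul hP').aemeasurable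
  rw [← lintegral_indicator hs]
  refine lintegral_congr_ae ?_
  filter_upwards [Measure.ae_ne volume (0 : ℝ)] with y hy
  have hPy : Measurable fun a => gammaPDF (m + τ : ℕ) 1 a *
      (ENNReal.ofReal (c * a)⁻¹ * gammaPDF m 1 ((c * a)⁻¹ * y)) :=
    hP'.comp (measurable_id.prodMk (measurable_const (a := y)))
  rw [lintegral_const_mul _ hPy,
    lintegral_gammaPDF_mul_gammaPDF_div hm hc hy]
  by_cases h : y ∈ s <;> simp [h]

theorem pi_withDensity_ofReal {ι : Type*} [Fintype ι] {g : ι → ℝ → ℝ} (hg : ∀ i x, 0 ≤ g i x)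
    (hi : ∀ i, Integrable (g i)) :
    Measure.pi (fun i => volume.withDensity fun x => ENNReal.ofReal (g i x)) =
      (volume : Measure (ι → ℝ)).withDensity fun y => ENNReal.ofReal (∏ i, g i (y i)) := by
  have : ∀ i, IsFiniteMeasure (volume.withDensity fun x => ENNReal.ofReal (g i x)) := fun i =>
    isFiniteMeasure_withDensity_ofReal (hi i).hasFiniteIntegral
  refine (Measure.pi_eq fun s hs => ?_)
  rw [withDensity_apply _ (MeasurableSet.univ_pi hs), volume_pi, Measure.restrict_pi_pi,
    ← ofReal_integral_eq_lintegral_ofReal, integral_fintype_prod_eq_prod,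
    ENNReal.ofReal_prod_of_nonneg]
  · refine Finset.prod_congr rfl fun i _ => ?_
    rw [withDensity_apply _ (hs i), ofReal_integral_eq_lintegral_ofReal (hi i).integrableOn
      (ae_of_all _ (hg i))]
  · exact fun i _ => integral_nonneg (hg i)
  · exact Integrable.fintype_prod fun i => (hi i).integrableOn
  · exact ae_of_all _ fun y => Finset.prod_nonneg fun i _ => hg i _

/-! ### The Bessel-type integral near zero -/

theorem integral_pow_mul_inv_mul_exp_neg {τ : ℕ} (hτ : 1 ≤ τ) :
    ∫ a in Ioi (0 : ℝ), a ^ τ * a⁻¹ * Real.exp (-a) = Real.Gamma τ := by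
  rw [Real.Gamma_eq_integral (by exact_mod_cast hτ)]
  refine setIntegral_congr_fun measurableSet_Ioi fun a ha => ?_
  have ha : 0 < a := ha
  have e2 : (τ : ℝ) - 1 = ((τ - 1 : ℕ) : ℝ) := by push_cast [Nat.cast_sub hτ]; ring
  obtain ⟨k, rfl⟩ := Nat.exists_eq_add_of_le' hτ
  rw [e2, Real.rpow_natCast]
  field_simp
  simp [pow_succ, mul_comm]

theorem integrableOn_pow_mul_inv_mul_exp_neg {τ : ℕ} (hτ : 1 ≤ τ) :
    IntegrableOn (fun a : ℝ => a ^ τ * a⁻¹ * Real.exp (-a)) (Ioi 0) := by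
  -- A non-integrable function has integral 0 by convention, but the value found is Γ(τ) > 0.
  by_contra h
  have h1 := integral_pow_mul_inv_mul_exp_neg hτ
  rw [integral_undef h] at h1
  exact (Real.Gamma_pos_of_pos (by exact_mod_cast hτ)).ne h1

theorem besselTypeIntegrand_le (τ : ℕ) {a x : ℝ} (ha : 0 < a) (hx : 0 < x) :
    a ^ τ * a⁻¹ * Real.exp (-a) * Real.exp (-(x / a)) ≤ a ^ τ * a⁻¹ * Real.exp (-a) :=
  mul_le_of_le_one_right (by positivity)
    (Real.exp_le_one_iff.2 (neg_nonpos.2 (by positivity)))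

theorem besselTypeIntegral_le_Gamma {τ : ℕ} (hτ : 1 ≤ τ) {x : ℝ} (hx : 0 < x) :
    besselTypeIntegral τ x ≤ Real.Gamma τ := by
  rw [← integral_pow_mul_inv_mul_exp_neg hτ]
  exact setIntegral_mono_on (integrableOn_besselTypeIntegrand τ hx)
    (integrableOn_pow_mul_inv_mul_exp_neg hτ) measurableSet_Ioi
    fun a ha => besselTypeIntegrand_le τ ha hx

/-- Dominated convergence, with the integrand at x = 0 as majorant; it is integrable because τ ≥ 1.
-/
theorem tendsto_besselTypeIntegral {τ : ℕ} (hτ : 1 ≤ τ) :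
    Tendsto (besselTypeIntegral τ) (𝓝[>] 0) (𝓝 (Real.Gamma τ)) := by
  rw [← integral_pow_mul_inv_mul_exp_neg hτ]
  refine tendsto_integral_filter_of_dominated_convergence
    (fun a => a ^ τ * a⁻¹ * Real.exp (-a)) (.of_forall fun x => by fun_prop) ?_
    (integrableOn_pow_mul_inv_mul_exp_neg hτ) ?_
  · filter_upwards [self_mem_nhdsWithin] with x hx
    filter_upwards [ae_restrict_mem measurableSet_Ioi] with a ha
    have : 0 < a := ha
    rw [Real.norm_of_nonneg (by positivity)]
    exact besselTypeIntegrand_le τ ha hx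
  · refine ae_of_all _ fun a => ?_
    have : Continuous fun x : ℝ => a ^ τ * a⁻¹ * Real.exp (-a) * Real.exp (-(x / a)) := by fun_prop
    simpa using (this.tendsto 0).mono_left nhdsWithin_le_nhds

/-- The integrand is bounded by 1/x on (0, r], by 1/a on (r, 1] and by e^(-a) beyond; these
contribute at most 1, -log r and 1. -/
theorem besselTypeIntegral_zero_le {x : ℝ} (hx : 0 < x) :
    besselTypeIntegral 0 x ≤ 2 + |Real.log x| := by
  -- The minimum covers x ≥ 1, where the middle interval is empty.
  set r := min x 1 with hr
  have hr0 : 0 < r := lt_min hx one_pos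
  have i1 : IntegrableOn ((Ioc 0 r).indicator fun _ => x⁻¹) (Ioi 0) :=
    ((integrable_indicator_iff measurableSet_Ioc).2 (integrableOn_const (by simp))).integrableOn
  have i2' : IntegrableOn (fun a : ℝ => a⁻¹) (Ioc r 1) :=
    (intervalIntegrable_iff_integrableOn_Ioc_of_le (min_le_right x 1)).1
      (intervalIntegrable_inv_iff.2 (.inr (notMem_uIcc_of_lt hr0 one_pos)))
  have i2 : IntegrableOn ((Ioc r 1).indicator fun a : ℝ => a⁻¹) (Ioi 0) :=
    ((integrable_indicator_iff measurableSet_Ioc).2 i2').integrableOn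
  have i3 : IntegrableOn (fun a : ℝ => Real.exp (-a)) (Ioi 0) := by
    simpa using integrableOn_pow_mul_exp_neg 0
  have hle : besselTypeIntegral 0 x ≤ ∫ a in Ioi (0 : ℝ), ((Ioc 0 r).indicator (fun _ => x⁻¹) a +
      (Ioc r 1).indicator (fun a : ℝ => a⁻¹) a + Real.exp (-a)) := by
    refine setIntegral_mono_on (integrableOn_besselTypeIntegrand 0 hx) ((i1.add i2).add i3)
      measurableSet_Ioi fun a ha => ?_
    have ha : 0 < a := ha
    have e1 : Real.exp (-a) ≤ 1 := Real.exp_le_one_iff.2 (by linarith)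
    have e2 : Real.exp (-(x / a)) ≤ 1 := Real.exp_le_one_iff.2 (neg_nonpos.2 (by positivity))
    have e3 := inv_mul_exp_neg_div_le ha hx
    have n1 : 0 ≤ (Ioc r 1).indicator (fun a : ℝ => a⁻¹) a :=
      indicator_nonneg (fun a ha => inv_nonneg.2 (hr0.le.trans ha.1.le)) a
    have n2 : 0 ≤ (Ioc 0 r).indicator (fun _ => x⁻¹) a :=
      indicator_nonneg (fun a ha => inv_nonneg.2 hx.le) a
    have n3 := Real.exp_pos (-a)
    rw [pow_zero, one_mul]
    rcases le_or_gt a r with h1 | h1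
    · rw [indicator_of_mem (show a ∈ Ioc 0 r from ⟨ha, h1⟩)]
      have : a⁻¹ * Real.exp (-a) * Real.exp (-(x / a)) ≤ x⁻¹ := by
        calc _ = Real.exp (-a) * (a⁻¹ * Real.exp (-(x / a))) := by ring
          _ ≤ 1 * x⁻¹ := by gcongr
          _ = _ := one_mul _
      linarith
    rcases le_or_gt a 1 with h2 | h2
    · rw [indicator_of_mem (show a ∈ Ioc r 1 from ⟨h1, h2⟩)]
      have : a⁻¹ * Real.exp (-a) * Real.exp (-(x / a)) ≤ a⁻¹ * 1 * 1 := by gcongr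
      linarith
    · have : a⁻¹ * Real.exp (-a) * Real.exp (-(x / a)) ≤ 1 * Real.exp (-a) * 1 := by
        gcongr
        exact inv_le_one_of_one_le₀ h2.le
      linarith
  have hs1 : (Ioi 0 : Set ℝ) ∩ Ioc 0 r = Ioc 0 r := inter_eq_right.2 fun a ha => ha.1
  have hs2 : (Ioi 0 : Set ℝ) ∩ Ioc r 1 = Ioc r 1 := inter_eq_right.2 fun a ha => hr0.trans ha.1
  have s1 : ∫ a in Ioi (0 : ℝ), (Ioc 0 r).indicator (fun _ => x⁻¹) a = r * x⁻¹ := by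
    rw [setIntegral_indicator measurableSet_Ioc, hs1]
    simp [hr0.le]
  have s2 : ∫ a in Ioi (0 : ℝ), (Ioc r 1).indicator (fun a : ℝ => a⁻¹) a = -Real.log r := by
    rw [setIntegral_indicator measurableSet_Ioc, hs2,
      ← intervalIntegral.integral_of_le (min_le_right x 1), integral_inv_of_pos hr0 one_pos]
    simp
  have s3 : ∫ a in Ioi (0 : ℝ), Real.exp (-a) = 1 := integral_exp_neg_Ioi_zero
  have i12 : IntegrableOn (fun a => (Ioc 0 r).indicator (fun _ => x⁻¹) a +
      (Ioc r 1).indicator (fun a : ℝ => a⁻¹) a) (Ioi 0) := i1.add i2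
  rw [integral_add i12 i3, integral_add i1 i2, s1, s2, s3] at hle
  have h1 : r * x⁻¹ ≤ 1 := by
    rw [← div_eq_mul_inv, div_le_one hx]
    exact min_le_left x 1
  have h2 : -Real.log r ≤ |Real.log x| := by
    rcases min_choice x 1 with h | h
    · rw [hr, h]; exact neg_le_abs _
    · rw [hr, h]; simp
  linarith

/-- On (x, 1] the inequality e^w ≥ 1 + w with w = -a - x/a bounds the integrand below by a function
with an elementary primitive. -/
theorem neg_log_sub_two_le_besselTypeIntegral_zero {x : ℝ} (hx : 0 < x) :
    -Real.log x - 2 ≤ besselTypeIntegral 0 x := by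
  rcases le_or_gt 1 x with h1 | h1
  · have := Real.log_nonneg h1
    linarith [besselTypeIntegral_nonneg 0 x]
  have hsub : Ioc x 1 ⊆ Ioi 0 := fun a ha => hx.trans ha.1
  have hint := integrableOn_besselTypeIntegrand 0 hx
  have hd : ∀ a ∈ uIcc x 1, HasDerivAt (fun a => Real.log a - a + x * a⁻¹)
      (a⁻¹ - 1 + x * (-(a ^ 2)⁻¹)) a := by
    intro a ha
    rw [uIcc_of_le h1.le] at ha
    have ha0 : a ≠ 0 := (hx.trans_le ha.1).ne'
    exact ((Real.hasDerivAt_log ha0).sub (hasDerivAt_id' a)).add ((hasDerivAt_inv ha0).const_mul x)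
  have hii : IntervalIntegrable (fun a => a⁻¹ - 1 + x * (-(a ^ 2)⁻¹)) volume x 1 := by
    refine ContinuousOn.intervalIntegrable fun a ha => ?_
    rw [uIcc_of_le h1.le] at ha
    have ha0 : a ≠ 0 := (hx.trans_le ha.1).ne'
    exact ContinuousAt.continuousWithinAt (by fun_prop (disch := simpa using ha0))
  have hF := intervalIntegral.integral_eq_sub_of_hasDerivAt hd hii
  rw [intervalIntegral.integral_of_le h1.le] at hF
  calc -Real.log x - 2 ≤ Real.log 1 - 1 + x * 1⁻¹ - (Real.log x - x + x * x⁻¹) := by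
        rw [mul_inv_cancel₀ hx.ne', Real.log_one]; linarith
    _ = ∫ a in Ioc x 1, (a⁻¹ - 1 + x * (-(a ^ 2)⁻¹)) := hF.symm
    _ ≤ ∫ a in Ioc x 1, a ^ 0 * a⁻¹ * Real.exp (-a) * Real.exp (-(x / a)) := by
        refine setIntegral_mono_on
          ((intervalIntegrable_iff_integrableOn_Ioc_of_le h1.le).1 hii) (hint.mono_set hsub)
          measurableSet_Ioc fun a ha => ?_
        have ha0 : 0 < a := hx.trans ha.1
        have := Real.add_one_le_exp (-a + -(x / a))
        rw [pow_zero, one_mul, mul_assoc, ← Real.exp_add]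
        calc a⁻¹ - 1 + x * (-(a ^ 2)⁻¹) = a⁻¹ * (-a + -(x / a) + 1) := by field_simp; ring
          _ ≤ _ := by gcongr
    _ ≤ besselTypeIntegral 0 x := by
        refine setIntegral_mono_set hint ?_ (LE.le.eventuallyLE hsub)
        filter_upwards [ae_restrict_mem measurableSet_Ioi] with a ha
        have : 0 < a := ha
        positivity

/-- The order of growth of `besselTypeIntegral τ x` as `x = O(1 / γ)`. -/
noncomputable def besselGrowth (τ : ℕ) (γ : ℝ) : ℝ := if τ = 0 then Real.log γ else Real.Gamma τ

/-- This provides the majorant for the high-SNR limit, so the threshold on γ must not depend on y.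
For τ = 0, once log γ ≥ 1, the bound 2 + log γ + |log N| + |log y| is at most (3 + |log N|)(1 + |log
y|) log γ. -/
theorem exists_besselTypeIntegral_div_growth_le (τ : ℕ) {N : ℝ} (hN : 0 < N) :
    ∃ C : ℝ, 0 ≤ C ∧ ∀ᶠ γ in atTop, ∀ y : ℝ, 0 < y →
      besselTypeIntegral τ ((γ / N)⁻¹ * y) / besselGrowth τ γ ≤ C * (1 + |Real.log y|) := by
  rcases Nat.eq_zero_or_pos τ with rfl | hτ
  · refine ⟨3 + |Real.log N|, by positivity, ?_⟩
    filter_upwards [eventually_ge_atTop (Real.exp 1)] with γ hγ y hy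
    have hγ0 : 0 < γ := (Real.exp_pos 1).trans_le hγ
    have hl : 1 ≤ Real.log γ := (Real.le_log_iff_exp_le hγ0).2 hγ
    rw [besselGrowth, if_pos rfl, div_le_iff₀ (by linarith)]
    refine (besselTypeIntegral_zero_le (by positivity)).trans ?_
    have : Real.log ((γ / N)⁻¹ * y) = -Real.log γ + Real.log N + Real.log y := by
      rw [Real.log_mul (by positivity) hy.ne', Real.log_inv, Real.log_div hγ0.ne' hN.ne']; ring
    have h3 : |Real.log ((γ / N)⁻¹ * y)| ≤ Real.log γ + |Real.log N| + |Real.log y| := by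
      rw [this]
      refine (abs_add_three _ _ _).trans ?_
      rw [abs_neg, abs_of_nonneg (by linarith : 0 ≤ Real.log γ)]
    have p1 := abs_nonneg (Real.log N)
    have p2 := abs_nonneg (Real.log y)
    nlinarith [mul_nonneg p1 p2, mul_nonneg (mul_nonneg p1 p2) (by linarith : 0 ≤ Real.log γ),
      mul_nonneg p1 (by linarith : 0 ≤ Real.log γ - 1),
      mul_nonneg p2 (by linarith : 0 ≤ Real.log γ - 1)]
  · refine ⟨1, zero_le_one, ?_⟩
    filter_upwards [eventually_gt_atTop 0] with γ hγ y hy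
    have hG : 0 < Real.Gamma τ := Real.Gamma_pos_of_pos (by exact_mod_cast hτ)
    rw [besselGrowth, if_neg hτ.ne', div_le_iff₀ hG]
    refine (besselTypeIntegral_le_Gamma hτ (by positivity)).trans ?_
    nlinarith [abs_nonneg (Real.log y)]

/-- For τ = 0 the two logarithmic bounds squeeze the quotient between (log γ + B ∓ 2)/log γ with B =
-(log N + log y). -/
theorem tendsto_besselTypeIntegral_div_growth (τ : ℕ) {N y : ℝ} (hN : 0 < N) (hy : 0 < y) :
    Tendsto (fun γ => besselTypeIntegral τ ((γ / N)⁻¹ * y) / besselGrowth τ γ) atTop (𝓝 1) := by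
  rcases Nat.eq_zero_or_pos τ with rfl | hτ
  · simp only [besselGrowth, if_pos]
    have hlog : ∀ B : ℝ, Tendsto (fun γ => (Real.log γ + B) / Real.log γ) atTop (𝓝 1) := by
      intro B
      have h1 : Tendsto (fun γ => 1 + B / Real.log γ) atTop (𝓝 (1 + 0)) :=
        tendsto_const_nhds.add (Real.tendsto_log_atTop.const_div_atTop B)
      rw [add_zero] at h1
      refine h1.congr' ?_
      filter_upwards [eventually_gt_atTop 1] with γ hγ
      have := (Real.log_pos hγ).ne'
      field_simp
    have key : ∀ γ : ℝ, 0 < γ → -Real.log ((γ / N)⁻¹ * y) =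
        Real.log γ + -(Real.log N + Real.log y) := by
      intro γ hγ
      rw [Real.log_mul (by positivity) hy.ne', Real.log_inv, Real.log_div hγ.ne' hN.ne']; ring
    have hb : ∀ᶠ γ : ℝ in atTop, 1 < γ ∧ Real.log ((γ / N)⁻¹ * y) ≤ 0 := by
      have h0 : Tendsto (fun γ : ℝ => Real.log γ) atTop atTop := Real.tendsto_log_atTop
      filter_upwards [eventually_gt_atTop 1, h0.eventually_ge_atTop (Real.log N + Real.log y)]
        with γ h1 h2
      refine ⟨h1, ?_⟩
      linarith [key γ (by linarith)]
    refine tendsto_of_tendsto_of_tendsto_of_le_of_le' (hlog (-(Real.log N + Real.log y) - 2))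
      (hlog (-(Real.log N + Real.log y) + 2)) ?_ ?_
    · filter_upwards [hb] with γ ⟨h1, h2⟩
      have := Real.log_pos h1
      gcongr
      have h3 := key γ (by linarith)
      have h4 := neg_log_sub_two_le_besselTypeIntegral_zero (x := (γ / N)⁻¹ * y) (by positivity)
      linarith
    · filter_upwards [hb] with γ ⟨h1, h2⟩
      have := Real.log_pos h1
      gcongr
      have h3 := key γ (by linarith)
      have h4 := besselTypeIntegral_zero_le (x := (γ / N)⁻¹ * y) (by positivity)
      rw [abs_of_nonpos h2] at h4
      linarith
  · have hG : 0 < Real.Gamma τ := Real.Gamma_pos_of_pos (by exact_mod_cast hτ)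
    simp only [besselGrowth, if_neg hτ.ne']
    rw [← div_self hG.ne']
    refine Tendsto.div_const ((tendsto_besselTypeIntegral hτ).comp ?_) _
    refine tendsto_nhdsWithin_iff.2 ⟨?_, ?_⟩
    · have h1 : Tendsto (fun γ : ℝ => γ / N) atTop atTop := tendsto_id.atTop_div_const hN
      simpa using h1.inv_tendsto_atTop.mul_const y
    · filter_upwards [eventually_gt_atTop 0] with γ hγ
      have : 0 < (γ / N)⁻¹ * y := by positivity
      exact this

/-! ### The beta integral with complex exponent -/

/-- The quotient `Γ(s - m) / Γ(s)` as a rational function. -/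
noncomputable def gammaRatio (m : ℕ) (s : ℂ) : ℂ := ∏ j ∈ Finset.range m, (s - (j + 1))⁻¹

theorem Gamma_sub_nat_eq_gammaRatio_mul {m : ℕ} {s : ℂ} (hs : (m : ℝ) < s.re) :
    Complex.Gamma (s - m) = gammaRatio m s * Complex.Gamma s := by
  induction m with
  | zero => simp [gammaRatio]
  | succ m ih =>
    push_cast at hs
    have h1 : s - (m + 1) ≠ 0 := fun h => by
      have := congrArg Complex.re h
      simp at this
      linarith
    have h2 := Complex.Gamma_add_one _ h1
    rw [show s - (m + 1) + 1 = s - m by ring, ih (by linarith)] at h2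
    rw [gammaRatio, Finset.prod_range_succ, ← gammaRatio, mul_right_comm, h2]
    push_cast
    field_simp

/-- All but the extreme factors of the two products agree. This is the recursion that the beta
integrals satisfy. -/
theorem gammaRatio_sub_one_sub {m : ℕ} {s : ℂ} (hs : (m : ℝ) + 2 < s.re) :
    gammaRatio (m + 1) (s - 1) - gammaRatio (m + 1) s = (m + 1) * gammaRatio (m + 2) s := by
  have h1 : s - 1 ≠ 0 := fun h => by
    have := congrArg Complex.re h
    have h0 : (0 : ℝ) ≤ m := Nat.cast_nonneg m
    simp at this
    linarith
  have h2 : s - (m + 2) ≠ 0 := fun h => by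
    have := congrArg Complex.re h
    simp at this
    linarith
  have e1 : gammaRatio (m + 1) (s - 1) =
      (∏ j ∈ Finset.range m, (s - (j + 2))⁻¹) * (s - (m + 2))⁻¹ := by
    rw [gammaRatio, Finset.prod_range_succ]
    congr 1
    · exact Finset.prod_congr rfl fun j _ => by ring
    · ring
  have e2 : gammaRatio (m + 1) s = (∏ j ∈ Finset.range m, (s - (j + 2))⁻¹) * (s - 1)⁻¹ := by
    rw [gammaRatio, Finset.prod_range_succ']
    congr 1
    · exact Finset.prod_congr rfl fun j _ => by push_cast; ring
    · simp
  have e3 : gammaRatio (m + 2) s =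
      (∏ j ∈ Finset.range m, (s - (j + 2))⁻¹) * (s - (m + 2))⁻¹ * (s - 1)⁻¹ := by
    rw [gammaRatio, Finset.prod_range_succ', Finset.prod_range_succ]
    congr 1
    · congr 1
      · exact Finset.prod_congr rfl fun j _ => by push_cast; ring
      · push_cast; ring
    · simp
  rw [e1, e2, e3]
  field_simp
  ring

/-- Induction on n through y (1 + y)^(-s) = (1 + y)^(-(s-1)) - (1 + y)^(-s), which lowers n and
costs one unit of Re s. -/
theorem integrableOn_and_integral_pow_mul_one_add_cpow (n : ℕ) :
    ∀ s : ℂ, (n : ℝ) + 1 < s.re →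
      IntegrableOn (fun y : ℝ => (y : ℂ) ^ n * (1 + y : ℂ) ^ (-s)) (Ioi 0) ∧
      ∫ y in Ioi (0 : ℝ), (y : ℂ) ^ n * (1 + y : ℂ) ^ (-s) =
        n.factorial * gammaRatio (n + 1) s := by
  induction n with
  | zero =>
    intro s hs
    norm_num at hs
    have hmp := measurePreserving_add_left (volume : Measure ℝ) 1
    have hemb := (MeasurableEquiv.addLeft (1 : ℝ)).measurableEmbedding
    have hpre : (fun y : ℝ => 1 + y) ⁻¹' Ioi 1 = Ioi 0 := by ext; simp
    have hs' : (-s).re < -1 := by simpa using hs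
    have hI := integrableOn_Ioi_cpow_of_lt hs' one_pos
    have hV := integral_Ioi_cpow_of_lt hs' one_pos
    have h1 := (hmp.integrableOn_comp_preimage hemb).2 hI
    have h2 := hmp.setIntegral_preimage_emb hemb (fun t : ℝ => (t : ℂ) ^ (-s)) (Ioi 1)
    rw [hpre] at h1 h2
    rw [hV] at h2
    simp only [pow_zero, one_mul, gammaRatio, Finset.prod_range_one, zero_add, Nat.factorial_zero,
      Nat.cast_one, Nat.cast_zero]
    refine ⟨by simpa [Function.comp_def] using h1, ?_⟩
    simp only [Complex.ofReal_add, Complex.ofReal_one, Complex.one_cpow] at h2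
    rw [h2, neg_div, ← div_neg, neg_add, neg_neg, ← sub_eq_add_neg, one_div]
  | succ n ih =>
    intro s hs
    push_cast at hs
    have hs1 : (n : ℝ) + 1 < (s - 1).re := by simp; linarith
    obtain ⟨i1, v1⟩ := ih (s - 1) hs1
    obtain ⟨i2, v2⟩ := ih s (by linarith)
    have heq : ∀ y ∈ Ioi (0 : ℝ), (y : ℂ) ^ n * (1 + y : ℂ) ^ (-(s - 1)) -
        (y : ℂ) ^ n * (1 + y : ℂ) ^ (-s) = (y : ℂ) ^ (n + 1) * (1 + y : ℂ) ^ (-s) := by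
      intro y hy
      have hy : 0 < y := hy
      have : (1 + y : ℂ) ≠ 0 := by exact_mod_cast (by linarith : (1 + y : ℝ) ≠ 0)
      rw [show -(s - 1) = -s + 1 by ring, Complex.cpow_add _ _ this, Complex.cpow_one]
      ring
    refine ⟨(i1.sub i2).congr_fun heq measurableSet_Ioi, ?_⟩
    rw [← setIntegral_congr_fun measurableSet_Ioi heq, integral_sub i1 i2, v1, v2, ← mul_sub,
      gammaRatio_sub_one_sub (by linarith), Nat.factorial_succ]
    push_cast
    ring

/-- The density `y ^ (m - 1) / Γ(m)` on the positive half-line. -/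
noncomputable def powerDensity (m : ℕ) (y : ℝ) : ℝ :=
  if 0 < y then y ^ (m - 1) / Real.Gamma m else 0

theorem powerDensity_nonneg (m : ℕ) (y : ℝ) : 0 ≤ powerDensity m y := by
  unfold powerDensity
  split_ifs with h
  · exact div_nonneg (pow_nonneg h.le _) (Real.Gamma_nonneg_of_nonneg (Nat.cast_nonneg _))
  · rfl

theorem powerDensity_pos {m : ℕ} (hm : 1 ≤ m) {y : ℝ} (hy : 0 < y) : 0 < powerDensity m y := by
  rw [powerDensity, if_pos hy]
  exact div_pos (pow_pos hy _) (Real.Gamma_pos_of_pos (by exact_mod_cast hm))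

theorem powerDensity_of_nonpos (m : ℕ) {y : ℝ} (hy : y ≤ 0) : powerDensity m y = 0 :=
  if_neg hy.not_gt

@[fun_prop]
theorem measurable_powerDensity (m : ℕ) : Measurable (powerDensity m) :=
  Measurable.ite measurableSet_Ioi (by fun_prop) measurable_const

theorem prod_powerDensity_eq_zero {ι : Type*} [Fintype ι] (m : ℕ) {y : ι → ℝ}
    (hy : ¬ ∀ k, 0 < y k) : ∏ k, powerDensity m (y k) = 0 := by
  push Not at hy
  obtain ⟨k, hk⟩ := hy
  exact Finset.prod_eq_zero (Finset.mem_univ k) (powerDensity_of_nonpos m hk)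

theorem integrable_and_integral_powerDensity_mul_one_add_cpow {m : ℕ} (hm : 1 ≤ m) {s : ℂ}
    (hs : (m : ℝ) < s.re) :
    Integrable (fun y : ℝ => (powerDensity m y : ℂ) * (1 + y : ℂ) ^ (-s)) ∧
      ∫ y : ℝ, (powerDensity m y : ℂ) * (1 + y : ℂ) ^ (-s) = gammaRatio m s := by
  obtain ⟨n, rfl⟩ := Nat.exists_eq_add_of_le' hm
  push_cast at hs
  obtain ⟨h1, h2⟩ := integrableOn_and_integral_pow_mul_one_add_cpow n s hs
  have hG : Real.Gamma ((n + 1 : ℕ) : ℝ) = n.factorial := by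
    push_cast; exact Real.Gamma_nat_eq_factorial n
  have heq : (fun y : ℝ => (powerDensity (n + 1) y : ℂ) * (1 + y : ℂ) ^ (-s)) =
      (Ioi (0 : ℝ)).indicator fun y : ℝ =>
        (n.factorial : ℂ)⁻¹ * ((y : ℂ) ^ n * (1 + y : ℂ) ^ (-s)) := by
    ext y
    by_cases hy : 0 < y
    · rw [indicator_of_mem (mem_Ioi.2 hy), powerDensity, if_pos hy, hG]
      simp
      ring
    · rw [indicator_of_notMem (by simpa using hy), powerDensity, if_neg hy]
      simp
  rw [heq]
  refine ⟨(integrable_indicator_iff measurableSet_Ioi).2 (h1.const_mul _), ?_⟩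
  rw [integral_indicator measurableSet_Ioi, integral_const_mul, h2, inv_mul_cancel_left₀]
  exact_mod_cast n.factorial_ne_zero

/-! ### The limiting mass: continuity and positivity -/

theorem integrableOn_Ioc_powerDensity_mul_log (m : ℕ) (b : ℝ) :
    Integrable ((Ioc 0 b).indicator fun y => powerDensity m y * (1 + |Real.log y|)) := by
  rw [integrable_indicator_iff measurableSet_Ioc]
  rcases le_or_gt b 0 with hb | hb
  · simp [Ioc_eq_empty_of_le hb]
  have h1 : IntegrableOn (fun y => 1 + |Real.log y|) (Ioc 0 b) :=
    (intervalIntegrable_iff_integrableOn_Ioc_of_le hb.le).1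
      (intervalIntegrable_const.add intervalIntegral.intervalIntegrable_log'.abs)
  refine h1.bdd_mul (c := b ^ (m - 1) / Real.Gamma m) (by fun_prop) ?_
  filter_upwards [ae_restrict_mem measurableSet_Ioc] with y hy
  rw [Real.norm_of_nonneg (powerDensity_nonneg m y), powerDensity, if_pos hy.1]
  have := Real.Gamma_nonneg_of_nonneg (Nat.cast_nonneg (α := ℝ) m)
  have := hy.1.le
  have := hy.2
  gcongr

theorem one_add_le_prod_one_add {ι : Type*} [Fintype ι] {y : ι → ℝ} (hy : ∀ k, 0 ≤ y k) (k : ι) :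
    1 + y k ≤ ∏ i, (1 + y i) := by
  classical
  rw [← Finset.mul_prod_erase _ _ (Finset.mem_univ k)]
  refine le_mul_of_one_le_right (by linarith [hy k]) ?_
  exact Finset.prod_induction _ (fun x : ℝ => 1 ≤ x)
    (fun a b ha hb => one_le_mul_of_one_le_of_one_le ha hb)
    le_rfl fun i _ => by linarith [hy i]

/-- With the other coordinates fixed and positive, the equation determines the first one, so every
slice has at most one point and Fubini applies. -/
theorem ae_prod_one_add_ne {K : ℕ} (hK : 1 ≤ K) (x : ℝ) :
    ∀ᵐ y : Fin K → ℝ, (∀ k, 0 < y k) → ∏ k, (1 + y k) ≠ x := by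
  obtain ⟨n, rfl⟩ := Nat.exists_eq_add_of_le' hK
  have hmeas : MeasurableSet {y : Fin (n + 1) → ℝ | (∀ k, 0 < y k) ∧ ∏ k, (1 + y k) = x} := by
    have h : {y : Fin (n + 1) → ℝ | (∀ k, 0 < y k) ∧ ∏ k, (1 + y k) = x} =
        (univ.pi fun _ => Ioi 0) ∩ {y | ∏ k, (1 + y k) = x} := by ext y; simp
    rw [h]
    exact (MeasurableSet.univ_pi fun _ => measurableSet_Ioi).inter
      (measurableSet_eq_fun (by fun_prop) measurable_const)
  have hmp := (volume_preserving_piFinSuccAbove (fun _ : Fin (n + 1) => ℝ) 0).symm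
  have hnull : volume {y : Fin (n + 1) → ℝ | (∀ k, 0 < y k) ∧ ∏ k, (1 + y k) = x} = 0 := by
    rw [← hmp.measure_preimage hmeas.nullMeasurableSet, Measure.volume_eq_prod,
      Measure.prod_apply_symm (hmp.measurable hmeas)]
    refine (lintegral_congr fun z => ?_).trans lintegral_zero
    refine Set.Subsingleton.measure_zero (fun a ha b hb => ?_) _
    simp only [mem_preimage, Set.mem_ofPred_eq, MeasurableEquiv.piFinSuccAbove_symm_apply,
      Fin.insertNthEquiv, Equiv.coe_fn_mk, Fin.insertNth_zero, Fin.prod_univ_succ, Fin.cons_zero,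
      Fin.cons_succ, Fin.forall_fin_succ, cast_eq] at ha hb
    have hpos : 0 < ∏ i, (1 + z i) := Finset.prod_pos fun i _ => by linarith [ha.1.2 i]
    have := mul_right_cancel₀ hpos.ne' (ha.2.trans hb.2.symm)
    linarith
  rw [← compl_compl {y : Fin (n + 1) → ℝ | (∀ k, 0 < y k) ∧ ∏ k, (1 + y k) = x}] at hnull
  filter_upwards [mem_ae_iff.2 hnull] with y hy hpos heq
  exact hy ⟨hpos, heq⟩

/-- The mass that the product of the densities `powerDensity m` gives to the region
`∏ k, (1 + y k) ≤ x`. -/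
noncomputable def hyperbolicMass (K m : ℕ) (x : ℝ) : ℝ :=
  ∫ y : Fin K → ℝ, if ∏ k, (1 + y k) ≤ x then ∏ k, powerDensity m (y k) else 0

theorem prod_powerDensity_ite_le {K : ℕ} (m : ℕ) {x b : ℝ} (hb : x ≤ b) (y : Fin K → ℝ) :
    (if ∏ k, (1 + y k) ≤ x then ∏ k, powerDensity m (y k) else 0) ≤
      ∏ k, (Ioc 0 b).indicator (fun y => powerDensity m y * (1 + |Real.log y|)) (y k) := by
  have hnn : ∀ z, 0 ≤ (Ioc 0 b).indicator (fun y => powerDensity m y * (1 + |Real.log y|)) z :=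
    indicator_nonneg fun z _ => mul_nonneg (powerDensity_nonneg m z) (by positivity)
  split_ifs with h
  · by_cases hy : ∀ k, 0 < y k
    · refine Finset.prod_le_prod (fun k _ => powerDensity_nonneg m _) fun k _ => ?_
      have := one_add_le_prod_one_add (fun k => (hy k).le) k
      rw [indicator_of_mem (show y k ∈ Ioc 0 b from ⟨hy k, by linarith⟩)]
      exact le_mul_of_one_le_right (powerDensity_nonneg m _)
        (by linarith [abs_nonneg (Real.log (y k))])
    · rw [prod_powerDensity_eq_zero m hy]
      exact Finset.prod_nonneg fun k _ => hnn _
  · exact Finset.prod_nonneg fun k _ => hnn _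

theorem measurable_prod_powerDensity_ite {K : ℕ} (m : ℕ) (x : ℝ) :
    Measurable fun y : Fin K → ℝ =>
      if ∏ k, (1 + y k) ≤ x then ∏ k, powerDensity m (y k) else 0 :=
  Measurable.ite (measurableSet_le (by fun_prop) measurable_const) (by fun_prop) measurable_const

theorem norm_prod_powerDensity_ite {K : ℕ} (m : ℕ) (x : ℝ) (y : Fin K → ℝ) :
    ‖(if ∏ k, (1 + y k) ≤ x then ∏ k, powerDensity m (y k) else 0)‖ =
      if ∏ k, (1 + y k) ≤ x then ∏ k, powerDensity m (y k) else 0 := by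
  refine Real.norm_of_nonneg ?_
  split_ifs
  · exact Finset.prod_nonneg fun k _ => powerDensity_nonneg m _
  · rfl

theorem integrable_prod_powerDensity_ite {K : ℕ} (m : ℕ) (x : ℝ) :
    Integrable fun y : Fin K → ℝ =>
      if ∏ k, (1 + y k) ≤ x then ∏ k, powerDensity m (y k) else 0 := by
  refine Integrable.mono'
    (Integrable.fintype_prod fun _ => integrableOn_Ioc_powerDensity_mul_log m x)
    (measurable_prod_powerDensity_ite m x).aestronglyMeasurable (ae_of_all _ fun y => ?_)
  rw [norm_prod_powerDensity_ite]
  exact prod_powerDensity_ite_le m le_rfl y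

/-- The integrand jumps in x only on the null hypersurface ∏ (1 + y_k) = x. Continuity is what makes
Mellin inversion valid pointwise. -/
theorem continuousAt_hyperbolicMass {K : ℕ} (hK : 1 ≤ K) (m : ℕ) (x : ℝ) :
    ContinuousAt (hyperbolicMass K m) x := by
  refine continuousAt_of_dominated (bound := fun y => ∏ k, (Ioc 0 (x + 1)).indicator
    (fun y => powerDensity m y * (1 + |Real.log y|)) (y k))
    (.of_forall fun x' => (measurable_prod_powerDensity_ite m x').aestronglyMeasurable) ?_
    (Integrable.fintype_prod fun _ => integrableOn_Ioc_powerDensity_mul_log m _) ?_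
  · filter_upwards [gt_mem_nhds (show x < x + 1 by linarith)] with x' hx'
    refine ae_of_all _ fun y => ?_
    rw [norm_prod_powerDensity_ite]
    exact prod_powerDensity_ite_le m hx'.le y
  · filter_upwards [ae_prod_one_add_ne hK x] with y hy
    by_cases hpos : ∀ k, 0 < y k
    · rcases (hy hpos).lt_or_gt with h | h
      · refine ContinuousAt.congr (continuousAt_const (y := ∏ k, powerDensity m (y k))) ?_
        filter_upwards [lt_mem_nhds h] with x' hx'
        rw [if_pos hx'.le]
      · refine ContinuousAt.congr (continuousAt_const (y := (0 : ℝ))) ?_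
        filter_upwards [gt_mem_nhds h] with x' hx'
        rw [if_neg hx'.not_ge]
    · simp only [prod_powerDensity_eq_zero m hpos, ite_self]
      exact continuousAt_const

theorem hyperbolicMass_pos (K : ℕ) {m : ℕ} (hm : 1 ≤ m) {x : ℝ} (hx : 1 < x) :
    0 < hyperbolicMass K m x := by
  have hnn : ∀ y : Fin K → ℝ,
      0 ≤ if ∏ k, (1 + y k) ≤ x then ∏ k, powerDensity m (y k) else 0 := fun y => by
    rw [← norm_prod_powerDensity_ite]; exact norm_nonneg _
  rw [hyperbolicMass, integral_pos_iff_support_of_nonneg hnn (integrable_prod_powerDensity_ite m x)]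
  have hopen : IsOpen {y : Fin K → ℝ | (∀ k, 0 < y k) ∧ ∏ k, (1 + y k) < x} := by
    have h : {y : Fin K → ℝ | (∀ k, 0 < y k) ∧ ∏ k, (1 + y k) < x} =
        (univ.pi fun _ => Ioi 0) ∩ {y | ∏ k, (1 + y k) < x} := by ext y; simp
    rw [h]
    exact (isOpen_set_pi finite_univ fun _ _ => isOpen_Ioi).inter
      (isOpen_lt (by fun_prop) continuous_const)
  have hne : {y : Fin K → ℝ | (∀ k, 0 < y k) ∧ ∏ k, (1 + y k) < x}.Nonempty := by
    -- A diagonal point (δ, …, δ) with small δ > 0 lies in the region because x > 1.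
    have ht : Tendsto (fun δ : ℝ => (1 + δ) ^ K) (𝓝[>] 0) (𝓝 1) := by
      have : Continuous fun δ : ℝ => (1 + δ) ^ K := by fun_prop
      simpa using (this.tendsto 0).mono_left nhdsWithin_le_nhds
    obtain ⟨δ, h1, h2⟩ := ((ht.eventually (gt_mem_nhds hx)).and self_mem_nhdsWithin).exists
    exact ⟨fun _ => δ, fun _ => h2, by simpa using h1⟩
  refine (hopen.measure_pos volume hne).trans_le (measure_mono fun y hy => ?_)
  rw [Function.mem_support, if_pos hy.2.le]
  exact (Finset.prod_pos fun k _ => powerDensity_pos hm (hy.1 k)).ne'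

/-! ### The Mellin transform of the mass -/

theorem prod_powerDensity_mul_prod_cpow {K : ℕ} (m : ℕ) (y : Fin K → ℝ) (s : ℂ) :
    ((∏ k, powerDensity m (y k) : ℝ) : ℂ) * ((∏ k, (1 + y k) : ℝ) : ℂ) ^ (-s) =
      ∏ k, ((powerDensity m (y k) : ℂ) * (1 + y k : ℂ) ^ (-s)) := by
  by_cases hy : ∀ k, 0 < y k
  · rw [Finset.prod_mul_distrib]
    congr 1
    · push_cast; rfl
    · have h : ∀ t : Finset (Fin K), ((∏ k ∈ t, (1 + y k) : ℝ) : ℂ) ^ (-s) =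
          ∏ k ∈ t, (1 + y k : ℂ) ^ (-s) := by
        intro t
        induction t using Finset.induction_on with
        | empty => simp
        | insert a t ha ih =>
          rw [Finset.prod_insert ha, Finset.prod_insert ha, ← ih, Complex.ofReal_mul,
            Complex.mul_cpow_ofReal_nonneg (by linarith [hy a])
              (Finset.prod_nonneg fun k _ => by linarith [hy k])]
          push_cast
          rfl
      exact h _
  · rw [prod_powerDensity_eq_zero m hy]
    push Not at hy
    obtain ⟨k, hk⟩ := hy
    have h0 : (powerDensity m (y k) : ℂ) * (1 + y k : ℂ) ^ (-s) = 0 := by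
      rw [powerDensity_of_nonpos m hk, Complex.ofReal_zero, zero_mul]
    rw [Complex.ofReal_zero, zero_mul]
    exact (Finset.prod_eq_zero (Finset.mem_univ k) h0).symm

theorem integrable_and_integral_prod_powerDensity_mul_cpow {K m : ℕ} (hm : 1 ≤ m) {s : ℂ}
    (hs : (m : ℝ) < s.re) :
    Integrable (fun y : Fin K → ℝ =>
      ((∏ k, powerDensity m (y k) : ℝ) : ℂ) * ((∏ k, (1 + y k) : ℝ) : ℂ) ^ (-s)) ∧
    ∫ y : Fin K → ℝ,
      ((∏ k, powerDensity m (y k) : ℝ) : ℂ) * ((∏ k, (1 + y k) : ℝ) : ℂ) ^ (-s) =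
        gammaRatio m s ^ K := by
  obtain ⟨h1, h2⟩ := integrable_and_integral_powerDensity_mul_one_add_cpow hm hs
  simp_rw [prod_powerDensity_mul_prod_cpow]
  refine ⟨Integrable.fintype_prod fun _ => h1, ?_⟩
  rw [integral_fintype_prod_volume_eq_pow fun y : ℝ => (powerDensity m y : ℂ) * (1 + y : ℂ) ^ (-s),
    h2, Fintype.card_fin]

/-- The integrand of the double integral that represents the Mellin transform of
`t ↦ hyperbolicMass K m t⁻¹`. -/
noncomputable def massMellinKernel (K m : ℕ) (s : ℂ) (t : ℝ) (y : Fin K → ℝ) : ℂ :=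
  ((∏ k, powerDensity m (y k) : ℝ) : ℂ) *
    ((t : ℂ) ^ (s - 1) * (Ioc 0 1).indicator (fun _ => (1 : ℂ)) ((∏ k, (1 + y k)) * t))

/-- The indicator of (0, 1] has Mellin transform 1/s, and dilation by P = ∏ (1 + y_k) multiplies it
by P^(-s). -/
theorem integrableOn_and_integral_massMellinKernel {K m : ℕ} {s : ℂ} (hs : 0 < s.re)
    (y : Fin K → ℝ) :
    IntegrableOn (fun t => massMellinKernel K m s t y) (Ioi 0) ∧
      ∫ t in Ioi (0 : ℝ), massMellinKernel K m s t y =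
        s⁻¹ * (((∏ k, powerDensity m (y k) : ℝ) : ℂ) * ((∏ k, (1 + y k) : ℝ) : ℂ) ^ (-s)) := by
  by_cases hy : ∀ k, 0 < y k
  · have hP : 0 < ∏ k, (1 + y k) := Finset.prod_pos fun k _ => by linarith [hy k]
    obtain ⟨h1, h2⟩ := hasMellin_one_Ioc hs
    have h3 := (MellinConvergent.comp_mul_left hP).2 h1
    have h4 := mellin_comp_mul_left (indicator (Ioc 0 1) (fun _ => 1 : ℝ → ℂ)) s hP
    rw [h2] at h4
    simp only [massMellinKernel]
    refine ⟨h3.const_mul _, ?_⟩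
    rw [integral_const_mul]
    have h5 : ∫ t in Ioi (0 : ℝ), (t : ℂ) ^ (s - 1) *
        (Ioc 0 1).indicator (fun _ => (1 : ℂ)) ((∏ k, (1 + y k)) * t) =
        ((∏ k, (1 + y k) : ℝ) : ℂ) ^ (-s) • (1 / s) := h4
    rw [h5, smul_eq_mul]
    ring
  · simp [massMellinKernel, prod_powerDensity_eq_zero m hy]

/-- Absolute integrability thus reduces to the evaluations already known, at the real exponent Re s.
-/
theorem norm_massMellinKernel {K m : ℕ} {s : ℂ} {t : ℝ} (ht : 0 < t) (y : Fin K → ℝ) :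
    ((‖massMellinKernel K m s t y‖ : ℝ) : ℂ) = massMellinKernel K m s.re t y := by
  have h0 : 0 ≤ ∏ k, powerDensity m (y k) := Finset.prod_nonneg fun k _ => powerDensity_nonneg m _
  rw [massMellinKernel, massMellinKernel, norm_mul, norm_mul, Complex.norm_real,
    Real.norm_of_nonneg h0, Complex.norm_cpow_eq_rpow_re_of_pos ht,
    norm_indicator_eq_indicator_norm]
  have : ((t : ℂ) ^ ((s.re : ℂ) - 1)) = ((t ^ (s.re - 1) : ℝ) : ℂ) := by
    rw [Complex.ofReal_cpow ht.le]; push_cast; rfl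
  rw [this]
  by_cases h : (∏ k, (1 + y k)) * t ∈ Ioc (0 : ℝ) 1
  · simp [indicator_of_mem h]
  · simp [indicator_of_notMem h]

theorem integrable_massMellinKernel {K m : ℕ} (hm : 1 ≤ m) {s : ℂ} (hs : (m : ℝ) < s.re) :
    Integrable (Function.uncurry (massMellinKernel K m s))
      ((volume.restrict (Ioi 0)).prod volume) := by
  have hs0 : 0 < s.re := (Nat.cast_nonneg m).trans_lt hs
  have hmeas : Measurable (Function.uncurry (massMellinKernel K m s)) := by
    unfold Function.uncurry massMellinKernel
    refine Measurable.mul (by fun_prop) (Measurable.mul (by fun_prop) ?_)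
    have : Measurable fun p : ℝ × (Fin K → ℝ) => (∏ k, (1 + p.2 k)) * p.1 := by fun_prop
    exact (measurable_const.indicator measurableSet_Ioc).comp this
  refine (integrable_prod_iff' hmeas.aestronglyMeasurable).2
    ⟨ae_of_all _ fun y => (integrableOn_and_integral_massMellinKernel hs0 y).1, ?_⟩
  have hsr : (m : ℝ) < ((s.re : ℝ) : ℂ).re := hs
  have h1 := ((integrable_and_integral_prod_powerDensity_mul_cpow (K := K) hm hsr).1.const_mul
    (((s.re : ℝ) : ℂ))⁻¹).re
  refine h1.congr (ae_of_all _ fun y => ?_)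
  have h2 := (integrableOn_and_integral_massMellinKernel (m := m) (s := (s.re : ℂ)) hs0 y).2
  beta_reduce
  rw [← h2, ← setIntegral_congr_fun measurableSet_Ioi fun t ht => norm_massMellinKernel ht y,
    integral_complex_ofReal]
  rfl

theorem hyperbolicMass_inv_eq {K m : ℕ} {t : ℝ} (ht : 0 < t) (s : ℂ) :
    ∫ y : Fin K → ℝ, massMellinKernel K m s t y =
      (t : ℂ) ^ (s - 1) • ((hyperbolicMass K m t⁻¹ : ℝ) : ℂ) := by
  rw [hyperbolicMass, ← integral_complex_ofReal, smul_eq_mul, ← integral_const_mul]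
  refine integral_congr_ae (ae_of_all _ fun y => ?_)
  simp only [massMellinKernel]
  by_cases hy : ∀ k, 0 < y k
  · have hP : 0 < ∏ k, (1 + y k) := Finset.prod_pos fun k _ => by linarith [hy k]
    have hiff : (∏ k, (1 + y k)) * t ∈ Ioc (0 : ℝ) 1 ↔ ∏ k, (1 + y k) ≤ t⁻¹ := by
      rw [mem_Ioc, ← le_div_iff₀ ht, one_div]
      exact and_iff_right (mul_pos hP ht)
    by_cases h : ∏ k, (1 + y k) ≤ t⁻¹
    · rw [if_pos h, indicator_of_mem (hiff.2 h)]
      ring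
    · rw [if_neg h, indicator_of_notMem (mt hiff.1 h)]
      simp
  · simp [prod_powerDensity_eq_zero m hy]

/-- Fubini: integrating the kernel over y first gives the Mellin integrand, over t first a product
of K beta integrals. -/
theorem hasMellin_hyperbolicMass_inv {K m : ℕ} (hm : 1 ≤ m) {s : ℂ} (hs : (m : ℝ) < s.re) :
    HasMellin (fun t : ℝ => ((hyperbolicMass K m t⁻¹ : ℝ) : ℂ)) s (s⁻¹ * gammaRatio m s ^ K) := by
  have hs0 : 0 < s.re := (Nat.cast_nonneg m).trans_lt hs
  have hI := integrable_massMellinKernel (K := K) hm hs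
  have heq : ∀ t ∈ Ioi (0 : ℝ), (∫ y : Fin K → ℝ, massMellinKernel K m s t y) =
      (t : ℂ) ^ (s - 1) • ((hyperbolicMass K m t⁻¹ : ℝ) : ℂ) :=
    fun t ht => hyperbolicMass_inv_eq ht s
  refine ⟨?_, ?_⟩
  · have h1 : IntegrableOn (fun t => ∫ y : Fin K → ℝ, massMellinKernel K m s t y) (Ioi 0) :=
      hI.integral_prod_left
    exact h1.congr_fun heq measurableSet_Ioi
  · rw [mellin, ← setIntegral_congr_fun measurableSet_Ioi heq, integral_integral_swap hI]
    simp_rw [(integrableOn_and_integral_massMellinKernel hs0 _).2]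
    rw [integral_const_mul, (integrable_and_integral_prod_powerDensity_mul_cpow hm hs).2]

/-! ### The Mellin–Barnes integral and its inversion -/

/-- Only the decay of the factor (s - 1)⁻¹ is kept; every other factor is at most 1/(c - m). -/
theorem norm_gammaRatio_le {m : ℕ} (hm : 1 ≤ m) {c : ℝ} (hc : (m : ℝ) < c) (t : ℝ) :
    ‖gammaRatio m (c + t * Complex.I)‖ ≤
      ‖((c : ℂ) + t * Complex.I - 1)⁻¹‖ * ((c - m)⁻¹) ^ (m - 1) := by
  obtain ⟨n, rfl⟩ := Nat.exists_eq_add_of_le' hm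
  push_cast at hc
  rw [gammaRatio, Finset.prod_range_succ', norm_mul, mul_comm]
  have hd : 0 < c - ((n + 1 : ℕ) : ℝ) := by push_cast; linarith
  refine mul_le_mul (by simp) ?_ (norm_nonneg _) (norm_nonneg _)
  rw [norm_prod, Nat.add_sub_cancel]
  calc _ ≤ ∏ _j ∈ Finset.range n, (c - ((n + 1 : ℕ) : ℝ))⁻¹ := by
        refine Finset.prod_le_prod (fun _ _ => norm_nonneg _) fun j hj => ?_
        rw [norm_inv]
        refine inv_anti₀ hd ?_
        refine le_trans ?_ (Complex.abs_re_le_norm _)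
        have : (j : ℝ) + 1 ≤ n := by exact_mod_cast Finset.mem_range.1 hj
        refine le_trans ?_ (le_abs_self _)
        simp
        linarith
    _ = _ := by simp

theorem continuous_gammaRatio_line {m : ℕ} {c : ℝ} (hc : (m : ℝ) < c) :
    Continuous fun t : ℝ => gammaRatio m (c + t * Complex.I) := by
  unfold gammaRatio
  refine continuous_finsetProd _ fun j hj => Continuous.inv₀ (by fun_prop) fun t h => ?_
  have h1 : (j : ℝ) + 1 ≤ m := by exact_mod_cast Finset.mem_range.1 hj
  have := congrArg Complex.re h
  simp at this
  linarith

/-- The factor s⁻¹ and one of the K ≥ 1 ratios each decay like 1/|t|, and the remaining ratios are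
bounded, so 1/(1 + t²) dominates. -/
theorem integrable_inv_mul_gammaRatio_pow {K m : ℕ} (hK : 1 ≤ K) (hm : 1 ≤ m) {c : ℝ}
    (hc : (m : ℝ) < c) :
    Integrable fun t : ℝ => ((c : ℂ) + t * Complex.I)⁻¹ * gammaRatio m (c + t * Complex.I) ^ K := by
  have hm1 : (1 : ℝ) ≤ m := by exact_mod_cast hm
  obtain ⟨L, rfl⟩ := Nat.exists_eq_add_of_le' hK
  have hd : 0 < c - 1 := by linarith
  have hne : ∀ t : ℝ, (c : ℂ) + t * Complex.I ≠ 0 := fun t h => by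
    have := congrArg Complex.re h
    simp at this
    linarith
  -- For b ≥ r and r ≤ 1 one has |b + it| ≥ r√(1 + t²); this serves both b = c and b = c - 1.
  set r := min 1 (c - 1) with hr
  have hr0 : 0 < r := lt_min one_pos hd
  have hr1 : r ≤ 1 := min_le_left _ _
  have hrc : r ≤ c - 1 := min_le_right _ _
  have hsq : ∀ t b : ℝ, r ≤ b → ‖((b : ℂ) + t * Complex.I)⁻¹‖ ≤
      (r * √(1 + t ^ 2))⁻¹ := by
    intro t b hb
    rw [norm_inv]
    refine inv_anti₀ (by positivity) ?_
    rw [Complex.norm_add_mul_I]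
    refine Real.le_sqrt_of_sq_le ?_
    rw [mul_pow, Real.sq_sqrt (by positivity)]
    nlinarith [sq_nonneg t, mul_self_le_mul_self hr0.le hb, mul_self_le_mul_self hr0.le hr1]
  set D := ((c - m)⁻¹) ^ (m - 1) with hD
  have hD0 : 0 ≤ D := pow_nonneg (inv_nonneg.2 (by linarith)) _
  have hb : ∀ t : ℝ, ‖gammaRatio m (c + t * Complex.I)‖ ≤ (r * √(1 + t ^ 2))⁻¹ * D := by
    intro t
    refine (norm_gammaRatio_le hm hc t).trans ?_
    gcongr
    have := hsq t (c - 1) hrc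
    rwa [show ((c - 1 : ℝ) : ℂ) + t * Complex.I = (c : ℂ) + t * Complex.I - 1 by
      push_cast; ring] at this
  have hb' : ∀ t : ℝ, ‖gammaRatio m (c + t * Complex.I)‖ ≤ r⁻¹ * D := by
    intro t
    refine (hb t).trans ?_
    gcongr
    exact le_mul_of_one_le_right hr0.le (Real.one_le_sqrt.2 (by nlinarith [sq_nonneg t]))
  refine (integrable_inv_one_add_sq.const_mul ((r⁻¹) ^ 2 * D * (r⁻¹ * D) ^ L)).mono' ?_ ?_
  · exact (((Continuous.inv₀ (by fun_prop) hne)).mul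
      ((continuous_gammaRatio_line hc).pow _)).aestronglyMeasurable
  · refine ae_of_all _ fun t => ?_
    rw [norm_mul, norm_pow, pow_succ]
    calc _ ≤ (r * √(1 + t ^ 2))⁻¹ * ((r⁻¹ * D) ^ L * ((r * √(1 + t ^ 2))⁻¹ * D)) := by
          gcongr
          · exact hsq t c (by linarith)
          · exact hb' t
          · exact hb t
      _ = (r⁻¹) ^ 2 * D * (r⁻¹ * D) ^ L * ((√(1 + t ^ 2)) ^ 2)⁻¹ := by
          rw [mul_inv, ← inv_pow (√(1 + t ^ 2))]
          ring
      _ = _ := by rw [Real.sq_sqrt (by positivity)]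

/-- The parameter 1 only demands c > 0; the condition c > m comes from the parameters m + 1, which
occur since K ≥ 1. -/
theorem meijerGSeparates_iff {K m : ℕ} (c : ℝ) (hK : 1 ≤ K) :
    MeijerGSeparates 0 (K + 1) (upperParams K m) (lowerParams K) c ↔ (m : ℝ) < c := by
  have : Nonempty (Fin K) := ⟨⟨0, hK⟩⟩
  simp only [MeijerGSeparates, upperParams, Nat.not_lt_zero, false_imp_iff, implies_true, true_and,
    Fin.is_lt, forall_const, Fin.forall_fin_succ, Fin.cons_zero, Fin.cons_succ]
  simp
  intro h
  exact (Nat.cast_nonneg m).trans_lt h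

theorem meijerGIntegrand_outage_eq {K m : ℕ} (z : ℂ) {s : ℂ} (hs : (m : ℝ) < s.re) :
    meijerGIntegrand 0 (K + 1) (upperParams K m) (lowerParams K) z s =
      z ^ s * (s⁻¹ * gammaRatio m s ^ K) := by
  have hs0 : 0 < s.re := (Nat.cast_nonneg m).trans_lt hs
  have hG : Complex.Gamma s ≠ 0 := Complex.Gamma_ne_zero_of_re_pos hs0
  have hs1 : s ≠ 0 := fun h => by simp [h] at hs0
  have h1 : ∏ j : Fin (K + 1), (if (j : ℕ) < K + 1 then
      Complex.Gamma (1 - upperParams K m j + s) else 1) =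
      Complex.Gamma s * Complex.Gamma (s - m) ^ K := by
    simp only [Fin.is_lt, if_true, Fin.prod_univ_succ, upperParams, Fin.cons_zero, Fin.cons_succ,
      Finset.prod_const, Finset.card_univ, Fintype.card_fin]
    ring_nf
  have h2 : ∏ j : Fin (K + 1), (if (j : ℕ) < 0 then (1 : ℂ) else
      Complex.Gamma (1 - lowerParams K j + s)) =
      Complex.Gamma s ^ K * Complex.Gamma (s + 1) := by
    simp only [Nat.not_lt_zero, if_false, Fin.prod_univ_castSucc, lowerParams, Fin.snoc_castSucc,
      Fin.snoc_last, Finset.prod_const, Finset.card_univ, Fintype.card_fin]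
    ring_nf
  have h3 : ∏ j : Fin (K + 1), (if (j : ℕ) < 0 then
      Complex.Gamma (lowerParams K j - s) else 1) = 1 := by simp
  have h4 : ∏ j : Fin (K + 1), (if (j : ℕ) < K + 1 then (1 : ℂ) else
      Complex.Gamma (upperParams K m j - s)) = 1 :=
    Finset.prod_eq_one fun j _ => if_pos j.is_lt
  rw [meijerGIntegrand, h1, h2, h3, h4, Gamma_sub_nat_eq_gammaRatio_mul hs,
    Complex.Gamma_add_one _ hs1, mul_pow]
  field_simp

theorem integrable_meijerGIntegrand_outage {K m : ℕ} (hK : 1 ≤ K) (hm : 1 ≤ m) {c : ℝ}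
    (hc : (m : ℝ) < c) {x : ℝ} (hx : 0 < x) :
    Integrable fun t : ℝ => meijerGIntegrand 0 (K + 1) (upperParams K m) (lowerParams K) (x : ℂ)
      (c + t * Complex.I) := by
  have hre : ∀ t : ℝ, (m : ℝ) < ((c : ℂ) + t * Complex.I).re := fun t => by simpa using hc
  simp_rw [fun t => meijerGIntegrand_outage_eq (K := K) (x : ℂ) (hre t)]
  have hx' : (x : ℂ) ≠ 0 := by exact_mod_cast hx.ne'
  refine (integrable_inv_mul_gammaRatio_pow hK hm hc).bdd_mul (c := x ^ c) ?_
    (ae_of_all _ fun t => ?_)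
  · exact (Continuous.const_cpow (by fun_prop) (.inl hx')).aestronglyMeasurable
  · rw [Complex.norm_cpow_eq_rpow_re_of_pos hx]
    simp

/-- Mellin inversion of t ↦ V(1/t) at t = 1/x, where t^(-s) = x^s. -/
theorem meijerGLine_outage_eq {K m : ℕ} (hK : 1 ≤ K) (hm : 1 ≤ m) {c : ℝ} (hc : (m : ℝ) < c)
    {x : ℝ} (hx : 0 < x) :
    meijerGLine 0 (K + 1) (upperParams K m) (lowerParams K) (x : ℂ) c =
      ((hyperbolicMass K m x : ℝ) : ℂ) := by
  have hre : ∀ t : ℝ, (m : ℝ) < ((c : ℂ) + t * Complex.I).re := fun t => by simpa using hc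
  have hmel : ∀ t : ℝ, mellin (fun t : ℝ => ((hyperbolicMass K m t⁻¹ : ℝ) : ℂ))
      ((c : ℂ) + t * Complex.I) = ((c : ℂ) + t * Complex.I)⁻¹ *
        gammaRatio m (c + t * Complex.I) ^ K := fun t => (hasMellin_hyperbolicMass_inv hm (hre t)).2
  have hcont : ContinuousAt (fun t : ℝ => ((hyperbolicMass K m t⁻¹ : ℝ) : ℂ)) x⁻¹ := by
    have h1 : ContinuousAt (fun t : ℝ => hyperbolicMass K m t⁻¹) x⁻¹ :=
      ContinuousAt.comp (g := hyperbolicMass K m) (continuousAt_hyperbolicMass hK m _)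
        (continuousAt_inv₀ (inv_pos.2 hx).ne')
    exact Complex.continuous_ofReal.continuousAt.comp h1
  have hinv := mellinInv_mellin_eq c (fun t : ℝ => ((hyperbolicMass K m t⁻¹ : ℝ) : ℂ))
    (inv_pos.2 hx) (hasMellin_hyperbolicMass_inv hm (by simpa using hc)).1
    (by
      unfold Complex.VerticalIntegrable
      simp_rw [hmel]
      exact integrable_inv_mul_gammaRatio_pow hK hm hc) hcont
  rw [inv_inv] at hinv
  rw [← hinv, mellinInv, meijerGLine]
  simp_rw [hmel, fun t => meijerGIntegrand_outage_eq (K := K) (x : ℂ) (hre t)]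
  rw [integral_mul_const]
  have hpow : ∀ t : ℝ, ((x⁻¹ : ℝ) : ℂ) ^ (-((c : ℂ) + t * Complex.I)) =
      (x : ℂ) ^ ((c : ℂ) + t * Complex.I) := by
    intro t
    rw [Complex.cpow_neg, Complex.ofReal_inv, Complex.inv_cpow, inv_inv]
    rw [Complex.arg_ofReal_of_nonneg hx.le]
    exact Real.pi_ne_zero.symm
  simp_rw [hpow, smul_eq_mul, Complex.real_smul]
  push_cast
  have := Complex.I_ne_zero
  field_simp

theorem meijerG_outage_eq {K m : ℕ} (hK : 1 ≤ K) (hm : 1 ≤ m) {x : ℝ} (hx : 0 < x) :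
    meijerG 0 (K + 1) (upperParams K m) (lowerParams K) (x : ℂ) =
      ((hyperbolicMass K m x : ℝ) : ℂ) := by
  have h : ∃ c : ℝ, MeijerGSeparates 0 (K + 1) (upperParams K m) (lowerParams K) c :=
    ⟨m + 1, (meijerGSeparates_iff _ hK).2 (by linarith)⟩
  rw [meijerG, dif_pos h]
  exact meijerGLine_outage_eq hK hm ((meijerGSeparates_iff _ hK).1 h.choose_spec) hx

/-! ### The outage probability as an integral of densities -/

theorem hasLaw_const_mul_mul_of_gammaMeasure {Ω : Type*} [MeasurableSpace Ω] {μ : Measure Ω}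
    [IsProbabilityMeasure μ] {a b : ℕ} (ha : 1 ≤ a) (hb : 1 ≤ b) {A B : Ω → ℝ}
    (hA : HasLaw A (gammaMeasure a 1) μ) (hB : HasLaw B (gammaMeasure b 1) μ)
    (hAB : IndepFun A B μ) {c : ℝ} (hc : 0 < c) :
    HasLaw (fun ω => c * (A ω * B ω)) (volume.withDensity fun y =>
      ENNReal.ofReal (c⁻¹ * gammaProductPDF (min a b) (max a b - min a b) (c⁻¹ * y))) μ := by
  wlog hab : b ≤ a generalizing a b A B
  · simpa only [mul_comm, min_comm, max_comm] using this hb ha hB hA hAB.symm (not_le.1 hab).le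
  obtain ⟨τ, rfl⟩ := Nat.exists_eq_add_of_le hab
  rw [min_eq_right hab, max_eq_left hab, Nat.add_sub_cancel_left]
  refine ⟨((hA.aemeasurable.mul hB.aemeasurable).const_mul c), ?_⟩
  rw [← map_const_mul_mul_prod_gammaMeasure hb hc, ← hA.map_eq, ← hB.map_eq,
    ← (indepFun_iff_map_prod_eq_prod_map_map hA.aemeasurable hB.aemeasurable).1 hAB,
    AEMeasurable.map_map_of_aemeasurable (by fun_prop)
      (hA.aemeasurable.prodMk hB.aemeasurable)]
  rfl

/-- No estimate is needed: the function is the density of a probability measure, so its integral is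
1. -/
theorem integrable_gammaProductPDF_comp {m τ : ℕ} (hm : 1 ≤ m) {c : ℝ} (hc : 0 < c) :
    Integrable fun y => c⁻¹ * gammaProductPDF m τ (c⁻¹ * y) := by
  have h1 := isProbabilityMeasure_gammaMeasure (a := (m : ℕ)) (r := 1) (by positivity) one_pos
  have h2 := isProbabilityMeasure_gammaMeasure (a := (m + τ : ℕ)) (r := 1)
    (by exact_mod_cast (by omega : 0 < m + τ)) one_pos
  have hf : Measurable fun p : ℝ × ℝ => c * (p.1 * p.2) := by fun_prop
  have h3 := Measure.isProbabilityMeasure_map (μ := (gammaMeasure (m + τ : ℕ) 1).prod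
    (gammaMeasure m 1)) hf.aemeasurable
  rw [map_const_mul_mul_prod_gammaMeasure hm hc] at h3
  have hmeas : Measurable fun y => c⁻¹ * gammaProductPDF m τ (c⁻¹ * y) :=
    ((measurable_gammaProductPDF m τ).comp (measurable_const_mul _)).const_mul _
  have hnn : ∀ y, 0 ≤ c⁻¹ * gammaProductPDF m τ (c⁻¹ * y) := fun y =>
    mul_nonneg (inv_nonneg.2 hc.le) (gammaProductPDF_nonneg _ _ _)
  refine ⟨hmeas.aestronglyMeasurable, ?_⟩
  rw [hasFiniteIntegral_iff_ofReal (ae_of_all _ hnn)]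
  have := h3.measure_univ
  rw [withDensity_apply _ MeasurableSet.univ, Measure.restrict_univ] at this
  rw [this]
  exact ENNReal.one_lt_top

theorem measureReal_pi_withDensity_eq_integral {ι : Type*} [Fintype ι] {g : ι → ℝ → ℝ}
    (hg : ∀ i x, 0 ≤ g i x) (hi : ∀ i, Integrable (g i)) {S : Set (ι → ℝ)} (hS : MeasurableSet S) :
    (Measure.pi (fun i => volume.withDensity fun x => ENNReal.ofReal (g i x))).real S =
      ∫ y in S, ∏ i, g i (y i) := by
  rw [pi_withDensity_ofReal hg hi, measureReal_def, withDensity_apply _ hS,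
    ← ofReal_integral_eq_lintegral_ofReal, ENNReal.toReal_ofReal]
  · exact integral_nonneg fun y => Finset.prod_nonneg fun i _ => hg i _
  · exact (Integrable.fintype_prod hi).integrableOn
  · exact ae_of_all _ fun y => Finset.prod_nonneg fun i _ => hg i _

theorem mutualInfoIR_keyholeChannel_lt_iff {K NT NR : ℕ} {γ : Fin K → ℝ} (hγ : ∀ k, 0 < γ k)
    (u : Fin K → Fin NR → ℂ) (v : Fin K → Fin NT → ℂ) (R : ℝ) :
    mutualInfoIR γ (fun k => keyholeChannel (u k) (v k)) < R ↔
      ∏ k, (1 + γ k / NT * entrySqNorm (keyholeChannel (u k) (v k))) < 2 ^ R := by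
  have hpos : ∀ k, 0 < 1 + γ k / NT * entrySqNorm (keyholeChannel (u k) (v k)) := by
    intro k
    have : 0 ≤ entrySqNorm (keyholeChannel (u k) (v k)) :=
      Finset.sum_nonneg fun i _ => Finset.sum_nonneg fun j _ => by positivity
    have := (hγ k).le
    positivity
  simp only [mutualInfoIR, det_one_add_smul_keyholeChannel]
  rw [← Real.logb_prod _ _ fun k _ => (hpos k).ne',
    Real.logb_lt_iff_lt_rpow one_lt_two (Finset.prod_pos fun k _ => hpos k)]

section Outage

variable {Ω : Type*} [MeasurableSpace Ω] {μ : Measure Ω} [IsProbabilityMeasure μ] {K NT NR : ℕ}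
  {u : Fin K → Fin NR → Ω → ℂ} {v : Fin K → Fin NT → Ω → ℂ}
  {H : Fin K → Ω → Matrix (Fin NR) (Fin NT) ℂ}

theorem outageIR_eq_setIntegral (hNT : 1 ≤ NT) (hNR : 1 ≤ NR) (R : ℝ)
    (hu : ∀ k i, HasLaw (u k i) stdComplexNormal μ)
    (hv : ∀ k j, HasLaw (v k j) stdComplexNormal μ)
    (huv : ∀ k, iIndepFun (Sum.elim (u k) (v k)) μ)
    (hH : ∀ k ω, H k ω = keyholeChannel (fun i => u k i ω) (fun j => v k j ω))
    (hind : iIndepFun (m := fun _ => MeasurableSpace.pi) H μ) {γ : Fin K → ℝ}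
    (hγ : ∀ k, 0 < γ k) :
    outageIR μ H R γ = ∫ y in {y : Fin K → ℝ | ∏ k, (1 + y k) < 2 ^ R},
      ∏ k, ((γ k / NT)⁻¹ *
        gammaProductPDF (min NT NR) (max NT NR - min NT NR) ((γ k / NT)⁻¹ * y k)) := by
  have hN : (0 : ℝ) < NT := by exact_mod_cast hNT
  have hc : ∀ k, 0 < γ k / NT := fun k => div_pos (hγ k) hN
  have hlaw : ∀ k, HasLaw (fun ω => γ k / NT * entrySqNorm (H k ω)) (volume.withDensity fun y =>
      ENNReal.ofReal ((γ k / NT)⁻¹ *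
        gammaProductPDF (min NT NR) (max NT NR - min NT NR) ((γ k / NT)⁻¹ * y))) μ := by
    intro k
    have hu' : iIndepFun (u k) μ := (huv k).precomp (g := Sum.inl) Sum.inl_injective
    have hv' : iIndepFun (v k) μ := (huv k).precomp (g := Sum.inr) Sum.inr_injective
    have h := hasLaw_const_mul_mul_of_gammaMeasure hNT hNR
      (hasLaw_sum_norm_sq_of_stdComplexNormal hNT (hv k) hv')
      (hasLaw_sum_norm_sq_of_stdComplexNormal hNR (hu k) hu')
      (iIndepFun_sumElim_indepFun_sum_norm_sq (fun i => (hu k i).aemeasurable)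
        (fun j => (hv k j).aemeasurable) (huv k)).symm (hc k)
    convert h using 3 with ω
    rw [hH, entrySqNorm_keyholeChannel, mul_comm]
  have hind' : iIndepFun (fun k ω => γ k / NT * entrySqNorm (H k ω)) μ :=
    hind.comp (mβ := fun _ => MeasurableSpace.pi) (fun k A => γ k / NT * entrySqNorm A)
      fun k => measurable_entrySqNorm.const_mul _
  have hmap := hind'.map_fun_eq_pi_map fun k => (hlaw k).aemeasurable
  have hS : MeasurableSet {y : Fin K → ℝ | ∏ k, (1 + y k) < 2 ^ R} :=
    measurableSet_lt (by fun_prop) measurable_const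
  have hset : {ω | mutualInfoIR γ (fun k => H k ω) < R} =
      (fun ω k => γ k / NT * entrySqNorm (H k ω)) ⁻¹' {y | ∏ k, (1 + y k) < 2 ^ R} := by
    ext ω
    simp only [hH, Set.mem_ofPred_eq, mem_preimage]
    exact mutualInfoIR_keyholeChannel_lt_iff hγ _ _ R
  rw [outageIR, hset, ← map_measureReal_apply_of_aemeasurable
    (aemeasurable_pi_lambda _ fun k => (hlaw k).aemeasurable) hS, hmap]
  simp_rw [fun k => (hlaw k).map_eq]
  exact measureReal_pi_withDensity_eq_integral
    (g := fun k y => (γ k / NT)⁻¹ *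
        gammaProductPDF (min NT NR) (max NT NR - min NT NR) ((γ k / NT)⁻¹ * y))
    (fun k y => mul_nonneg (inv_nonneg.2 (hc k).le) (gammaProductPDF_nonneg _ _ _))
    (fun k => integrable_gammaProductPDF_comp (le_min hNT hNR) (hc k)) hS

end Outage

/-! ### The high-SNR limit -/

/-- The high-SNR scale of the density of one HARQ round. -/
noncomputable def outageScale (m τ : ℕ) (N γ : ℝ) : ℝ :=
  besselGrowth τ γ * (N / γ) ^ m / Real.Gamma (m + τ : ℕ)

theorem besselGrowth_pos (τ : ℕ) {γ : ℝ} (hγ : 1 < γ) : 0 < besselGrowth τ γ := by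
  unfold besselGrowth
  split_ifs with h
  · exact Real.log_pos hγ
  · exact Real.Gamma_pos_of_pos (by exact_mod_cast Nat.pos_of_ne_zero h)

/-- An exact factorization: the scale depends only on γ, the power density only on y, and the last
quotient tends to 1. -/
theorem gammaProductPDF_comp_eq_outageScale_mul {m τ : ℕ} (hm : 1 ≤ m) {N γ : ℝ} (hN : 0 < N)
    (hγ : 1 < γ) (y : ℝ) :
    (γ / N)⁻¹ * gammaProductPDF m τ ((γ / N)⁻¹ * y) = outageScale m τ N γ *
      (powerDensity m y * (besselTypeIntegral τ ((γ / N)⁻¹ * y) / besselGrowth τ γ)) := by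
  have hγ0 : 0 < γ := one_pos.trans hγ
  have hc : 0 < (γ / N)⁻¹ := by positivity
  by_cases hy : 0 < y
  · have hL := (besselGrowth_pos τ hγ).ne'
    obtain ⟨n, rfl⟩ := Nat.exists_eq_add_of_le' hm
    rw [gammaProductPDF, if_pos (mul_pos hc hy), powerDensity, if_pos hy, outageScale,
      show N / γ = (γ / N)⁻¹ by rw [inv_div], Nat.add_sub_cancel, mul_pow, pow_succ]
    field_simp
  · rw [gammaProductPDF, if_neg (by rwa [mul_pos_iff_of_pos_left hc]), powerDensity, if_neg hy]
    simp

/-- Dominated convergence along the product filter; each factor involves a single γ_k, so no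
relation between the rates is needed. The strict inequality here and the weak one in
`hyperbolicMass` differ on a null set. -/
theorem tendsto_setIntegral_prod_powerDensity_mul {K : ℕ} (hK : 1 ≤ K) (m τ : ℕ) {N : ℝ}
    (hN : 0 < N) (x : ℝ) :
    Tendsto (fun γ : Fin K → ℝ => ∫ y in {y : Fin K → ℝ | ∏ k, (1 + y k) < x},
      ∏ k, (powerDensity m (y k) *
        (besselTypeIntegral τ ((γ k / N)⁻¹ * y k) / besselGrowth τ (γ k))))
      (Filter.pi fun _ : Fin K => atTop) (𝓝 (hyperbolicMass K m x)) := by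
  have hS : MeasurableSet {y : Fin K → ℝ | ∏ k, (1 + y k) < x} :=
    measurableSet_lt (by fun_prop) measurable_const
  have hJ := measurable_besselTypeIntegral τ
  obtain ⟨C, hC0, hC⟩ := exists_besselTypeIntegral_div_growth_le τ hN
  simp_rw [← integral_indicator hS]
  refine tendsto_integral_filter_of_dominated_convergence (fun y => C ^ K *
    ∏ k, (Ioc 0 x).indicator (fun y => powerDensity m y * (1 + |Real.log y|)) (y k))
    (.of_forall fun γ => ?_) ?_
    ((Integrable.fintype_prod fun _ => integrableOn_Ioc_powerDensity_mul_log m x).const_mul _) ?_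
  · refine (Measurable.indicator ?_ hS).aestronglyMeasurable
    fun_prop
  · have hev : ∀ᶠ γ in Filter.pi fun _ : Fin K => (atTop : Filter ℝ), ∀ k, 1 < γ k ∧
        ∀ y : ℝ, 0 < y → besselTypeIntegral τ ((γ k / N)⁻¹ * y) / besselGrowth τ (γ k) ≤
          C * (1 + |Real.log y|) :=
      eventually_pi fun k => (eventually_gt_atTop 1).and hC
    filter_upwards [hev] with γ hγ
    refine ae_of_all _ fun y => ?_
    have hnn : 0 ≤ C ^ K *
        ∏ k, (Ioc 0 x).indicator (fun y => powerDensity m y * (1 + |Real.log y|)) (y k) :=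
      mul_nonneg (pow_nonneg hC0 _) (Finset.prod_nonneg fun k _ => indicator_nonneg
        (fun z _ => mul_nonneg (powerDensity_nonneg m z) (by positivity)) _)
    by_cases h : y ∈ {y : Fin K → ℝ | ∏ k, (1 + y k) < x}
    · rw [indicator_of_mem h]
      by_cases hy : ∀ k, 0 < y k
      · have hC' : C ^ K = ∏ _k : Fin K, C := by simp
        rw [norm_prod, hC', ← Finset.prod_mul_distrib]
        refine Finset.prod_le_prod (fun k _ => norm_nonneg _) fun k _ => ?_
        have h1 := one_add_le_prod_one_add (fun k => (hy k).le) k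
        have h2 : ∏ k, (1 + y k) < x := h
        rw [indicator_of_mem (show y k ∈ Ioc 0 x from ⟨hy k, by linarith⟩),
          Real.norm_of_nonneg (mul_nonneg (powerDensity_nonneg m _)
            (div_nonneg (besselTypeIntegral_nonneg _ _) (besselGrowth_pos τ (hγ k).1).le)),
          mul_left_comm]
        exact mul_le_mul_of_nonneg_left ((hγ k).2 _ (hy k)) (powerDensity_nonneg m _)
      · rw [Finset.prod_mul_distrib, prod_powerDensity_eq_zero m hy, zero_mul, norm_zero]
        exact hnn
    · rw [indicator_of_notMem h, norm_zero]
      exact hnn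
  · filter_upwards [ae_prod_one_add_ne hK x] with y hne
    by_cases hy : ∀ k, 0 < y k
    · by_cases h : y ∈ {y : Fin K → ℝ | ∏ k, (1 + y k) < x}
      · have h2 : ∏ k, (1 + y k) < x := h
        simp only [indicator_of_mem h, if_pos h2.le]
        refine tendsto_finsetProd _ fun k _ => ?_
        have h3 : Tendsto (fun γ : Fin K → ℝ => besselTypeIntegral τ ((γ k / N)⁻¹ * y k) /
            besselGrowth τ (γ k)) (Filter.pi fun _ : Fin K => atTop) (𝓝 1) :=
          (tendsto_besselTypeIntegral_div_growth τ hN (hy k)).comp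
            (tendsto_eval_pi (fun _ : Fin K => (atTop : Filter ℝ)) k)
        simpa using h3.const_mul (powerDensity m (y k))
      · have h2 : ¬ ∏ k, (1 + y k) ≤ x := fun h' => h (lt_of_le_of_ne h' (hne hy))
        simp only [indicator_of_notMem h, if_neg h2]
        exact tendsto_const_nhds
    · have h0 : ∀ γ : Fin K → ℝ, ({y : Fin K → ℝ | ∏ k, (1 + y k) < x}.indicator
          (fun y => ∏ k, (powerDensity m (y k) *
            (besselTypeIntegral τ ((γ k / N)⁻¹ * y k) / besselGrowth τ (γ k)))) y) = 0 := by
        intro γ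
        refine indicator_apply_eq_zero.2 fun _ => ?_
        rw [Finset.prod_mul_distrib, prod_powerDensity_eq_zero m hy, zero_mul]
      simp only [h0, prod_powerDensity_eq_zero m hy, ite_self]
      exact tendsto_const_nhds

theorem outageScale_eq {NT NR : ℕ} (γ : ℝ) :
    outageScale (min NT NR) (max NT NR - min NT NR) NT γ =
      (if NT = NR then Real.log γ else Real.Gamma |(NT : ℝ) - (NR : ℝ)|) *
        ((NT : ℝ) / γ) ^ (min NT NR) / Real.Gamma (max NT NR : ℕ) := by
  have h1 : min NT NR + (max NT NR - min NT NR) = max NT NR := by omega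
  rw [outageScale, h1, besselGrowth]
  congr 2
  have h2 : max NT NR - min NT NR = 0 ↔ NT = NR := by omega
  by_cases h : NT = NR
  · rw [if_pos (h2.2 h), if_pos h]
  · rw [if_neg (mt h2.1 h), if_neg h]
    congr 1
    rw [Nat.cast_sub (by omega), Nat.cast_max, Nat.cast_min, max_sub_min_eq_abs']

theorem theorem5 {Ω : Type*} [MeasurableSpace Ω] (μ : Measure Ω) [IsProbabilityMeasure μ]
    (K NT NR : ℕ) (hK : 1 ≤ K) (hNT : 1 ≤ NT) (hNR : 1 ≤ NR) (R : ℝ) (hR : 0 < R)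
    (u : Fin K → Fin NR → Ω → ℂ) (v : Fin K → Fin NT → Ω → ℂ)
    (hu : ∀ k i, HasLaw (u k i) stdComplexNormal μ)
    (hv : ∀ k j, HasLaw (v k j) stdComplexNormal μ)
    (huv : ∀ k, iIndepFun (Sum.elim (u k) (v k)) μ)
    (H : Fin K → Ω → Matrix (Fin NR) (Fin NT) ℂ)
    (hH : ∀ k ω, H k ω = keyholeChannel (fun i => u k i ω) (fun j => v k j ω))
    (hind : iIndepFun (m := fun _ => MeasurableSpace.pi) H μ) :
    -- the Meijer G-function below is given by a convergent integral, along any admissible line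
    (∃ c : ℝ, MeijerGSeparates 0 (K + 1) (upperParams K (min NT NR)) (lowerParams K) c) ∧
    (∀ c : ℝ, MeijerGSeparates 0 (K + 1) (upperParams K (min NT NR)) (lowerParams K) c →
      Integrable (fun t : ℝ => meijerGIntegrand 0 (K + 1) (upperParams K (min NT NR))
        (lowerParams K) ((2 ^ R : ℝ) : ℂ) (c + t * Complex.I)) ∧
      meijerGLine 0 (K + 1) (upperParams K (min NT NR)) (lowerParams K) ((2 ^ R : ℝ) : ℂ) c =
        meijerG 0 (K + 1) (upperParams K (min NT NR)) (lowerParams K) ((2 ^ R : ℝ) : ℂ)) ∧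
    -- the asymptotic equality as all `γ k` tend to infinity, independently of each other
    (fun γ : Fin K → ℝ => ((outageIR μ H R γ : ℝ) : ℂ)) ~[Filter.pi fun _ : Fin K => atTop]
      (fun γ : Fin K → ℝ =>
        (∏ k, (((if NT = NR then Real.log (γ k) else Real.Gamma |(NT : ℝ) - (NR : ℝ)|) *
            ((NT : ℝ) / γ k) ^ (min NT NR) / Real.Gamma (max NT NR : ℕ) : ℝ) : ℂ)) *
          meijerG 0 (K + 1) (upperParams K (min NT NR)) (lowerParams K) ((2 ^ R : ℝ) : ℂ)) := by
  have hm : 1 ≤ min NT NR := le_min hNT hNR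
  have hN : (0 : ℝ) < NT := by exact_mod_cast hNT
  have hx0 : (0 : ℝ) < 2 ^ R := by positivity
  have hx1 : (1 : ℝ) < 2 ^ R := Real.one_lt_rpow one_lt_two hR
  refine ⟨⟨min NT NR + 1, (meijerGSeparates_iff _ hK).2 (by push_cast; linarith)⟩,
    fun c hc => ?_, ?_⟩
  · have hc' := (meijerGSeparates_iff _ hK).1 hc
    exact ⟨integrable_meijerGIntegrand_outage hK hm hc' hx0,
      (meijerGLine_outage_eq hK hm hc' hx0).trans (meijerG_outage_eq hK hm hx0).symm⟩
  rw [meijerG_outage_eq hK hm hx0]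
  simp_rw [← outageScale_eq]
  set τ := max NT NR - min NT NR with hτ
  have hlim := tendsto_setIntegral_prod_powerDensity_mul hK (min NT NR) τ hN (2 ^ R)
  have hV : ((hyperbolicMass K (min NT NR) (2 ^ R) : ℝ) : ℂ) ≠ 0 := by
    exact_mod_cast (hyperbolicMass_pos K hm hx1).ne'
  -- Convergence to a nonzero constant is asymptotic equivalence; hence the need for R > 0, which
  -- gives 2^R > 1.
  have hequiv := (isEquivalent_const_iff_tendsto hV).2
    ((Complex.continuous_ofReal.tendsto _).comp hlim)
  have hscale : (fun γ : Fin K → ℝ => ∏ k, ((outageScale (min NT NR) τ NT (γ k) : ℝ) : ℂ))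
      ~[Filter.pi fun _ : Fin K => atTop]
      fun γ => ∏ k, ((outageScale (min NT NR) τ NT (γ k) : ℝ) : ℂ) := IsEquivalent.refl
  -- Once all γ_k > 1, the outage probability equals the product of the scales times the convergent
  -- integral.
  refine (hscale.mul hequiv).congr_left ?_
  have hev : ∀ᶠ γ in Filter.pi fun _ : Fin K => (atTop : Filter ℝ), ∀ k, 1 < γ k :=
    eventually_pi fun k => eventually_gt_atTop 1
  filter_upwards [hev] with γ hγ
  rw [outageIR_eq_setIntegral hNT hNR R hu hv huv hH hind fun k => one_pos.trans (hγ k),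
    ← hτ]
  simp_rw [fun k => gammaProductPDF_comp_eq_outageScale_mul (τ := τ) hm hN (hγ k)]
  simp_rw [Finset.prod_mul_distrib (f := fun k => outageScale (min NT NR) τ NT (γ k))]
  rw [integral_const_mul]
  simp
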